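/- Logarithms are to base $2$. For a finite graph $G$, $\operatorname{cub}(G)$ is the least $d$ such that $G$ is the intersection graph of axis-parallel unit hypercubes in $\mathbb{R}^d$; a cube representation is given by the map sending each vertex to the centre of its cube. Let $T$ be a finite tree with at least two vertices, rooted at an arbitrary vertex $r$, with height $h$. Let $B_{v,s}$ be the set of vertices at distance at most $s$ from $v$, $$\rho(T)=\max_{v\in V(T),\ 1\le s\le \operatorname{diam}(T)}\frac{\log(|B_{v,s}|/2)}{\log(2s+1)},\qquad t=\lceil 22.77\,\rho(T)\rceil+2 .$$ For $W:E(T)\to[-1,1]^d$ let $S_W(v)$ be the sum of the vectors $W(e)$ over the edges $e$ of the path from $r$ to $v$; $W$ is separating for a pair of non-adjacent vertices $u\ne v$ if $\|S_W(u)-S_W(v)\|_\infty>1$. Decomposition. Let $k=\lceil\log\log h\rceil$ ($k=0$ if $h=1$) and $h_i=2^{2^{k-i}}$ for $0\le i\le k$ (and $h_i=2$ for $i>k$). Let $e$ (resp. $o$) be the least even (resp. odd) $i\ge 0$ with $h_i\le 2^{16}$. Let $O_i^A$ (resp. $O_i^B$) be the set of edges of $T$ joining depths $j$ and $j+1$ where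 $j$ is a positive multiple of $3h_i$ (resp. $j\equiv h_i \bmod 3h_i$). For $X\in\{A,B\}$ the level-$i$ subtrees of kind $X$ are the connected components of $T$ with the edges in $O_i^X$ deleted, each rooted at its vertex of least depth. Procedure. For $X\in\{A,B\}$ and $i\in\{e,o\}$, choose for each level-$i$ subtree $F$ of kind $X$ a $t$-dimensional cube representation with centre map $f_F$, and define $W_i^X:E(T)\setminus O_i^X\to[-1,1]^t$ by $W_i^X(uv)=f_F(u)-f_F(v)$ for each edge $uv$ of $F$, $u$ being the child of $v$. Then for each $i$ with $0\le i\le\max(e,o)-2$, in decreasing order, extend $W_{i+2}^X$ to $W_i^X:E(T)\setminus O_i^X\to[-1,1]^t$ by giving the edges of $O_{i+2}^X\setminus O_i^X$ independent uniformly random vectors of $\{-1,1\}^t$, repeating this in each level-$i$ subtree $F$ of kind $X$ until $F$ is accepted, i.e. until $\|S(u)-S(v)\|_\infty>1$ for all non-adjacent $u\neq v$ in $F$ at distance at least $h_{i+1}$, where $S$ is the vector sum along paths of $F$ from the root of $F$. No edge is deleted at level $0$. Let $W'^X_0$ equal $W_1^X$ on $E(T)\setminus O_1^X$ and $0$ on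 $O_1^X$. The output is the concatenation $\mathcal W=W_0^A\circ W_0^B\circ W'^A_0\circ W'^B_0:E(T)\to[-1,1]^{4t}$. Theorem. For every such $T$ and $r$: (1) every output $\mathcal W$ of the procedure is separating for every pair of non-adjacent vertices of $T$, and $v\mapsto S_{\mathcal W}(v)$ is the centre map of a $4t$-dimensional cube representation of $T$; (2) for each $X\in\{A,B\}$, each $i\ge 0$ with $i+2\le\max(e,o)$, each $W:E(T)\setminus O_{i+2}^X\to[-1,1]^t$ and each level-$i$ subtree $F$ of kind $X$, the random extension of $W$ to $E(T)\setminus O_i^X$ is accepted in $F$ with probability at least $0.64$; (3) the procedure can be carried out, i.e. it has an output; (4) $\operatorname{cub}(T)\le 4(\lceil 22.77\,\rho(T)\rceil+2)$. Moreover $\operatorname{cub}(T)=O(\rho(T))$: there is an absolute constant $C>0$ with $\operatorname{cub}(T)\le C\rho(T)$ for all finite trees $T$ with at least two vertices. -/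

import Mathlib

universe u

namespace TreeCubicity

/-! ### Cube representations, cubicity and the parameter `ρ` -/

/-- `f` assigns to each vertex the centre of an axis-parallel unit hypercube in `ℝ^d` (a closed ball
of radius `1/2` for the sup norm, which is the norm of `Fin d → ℝ`), and `G` is the intersection
graph of these hypercubes. -/
def IsCubeRep {V : Type u} (G : SimpleGraph V) {d : ℕ} (f : V → Fin d → ℝ) : Prop :=
  ∀ u v : V, u ≠ v →
    (G.Adj u v ↔
      (Metric.closedBall (f u) (1 / 2) ∩ Metric.closedBall (f v) (1 / 2)).Nonempty)

/-- The cubicity of a graph: the least dimension of a cube representation. -/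
noncomputable def cub {V : Type u} (G : SimpleGraph V) : ℕ :=
  sInf {d : ℕ | ∃ f : V → Fin d → ℝ, IsCubeRep G f}

theorem closedBall_half_inter_nonempty_iff {d : ℕ} (x y : Fin d → ℝ) :
    (Metric.closedBall x (1 / 2) ∩ Metric.closedBall y (1 / 2)).Nonempty ↔ ‖x - y‖ ≤ 1 := by
  constructor
  · rintro ⟨z, hx, hy⟩
    rw [Metric.mem_closedBall] at hx hy
    have h := dist_triangle_left x y z
    rw [dist_eq_norm] at h
    linarith
  · intro h
    have h2 : dist x y ≤ 1 := by rwa [dist_eq_norm]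
    refine ⟨midpoint ℝ x y, ?_, ?_⟩
    · rw [Metric.mem_closedBall, dist_midpoint_left]
      norm_num
      linarith
    · rw [Metric.mem_closedBall, dist_midpoint_right]
      norm_num
      linarith

theorem isCubeRep_iff {V : Type u} (G : SimpleGraph V) {d : ℕ} (f : V → Fin d → ℝ) :
    IsCubeRep G f ↔ ∀ u v : V, u ≠ v → (G.Adj u v ↔ ‖f u - f v‖ ≤ 1) := by
  simp only [IsCubeRep, closedBall_half_inter_nonempty_iff]

open Classical in
/-- Every finite graph has a cube representation, so `cub` is a genuine minimum. -/
theorem exists_isCubeRep {V : Type u} [Fintype V] (G : SimpleGraph V) :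
    ∃ (d : ℕ) (f : V → Fin d → ℝ), IsCubeRep G f := by
  let eq := Fintype.equivFin V
  refine ⟨Fintype.card V,
    fun u k => if u = eq.symm k then 0 else if G.Adj u (eq.symm k) then 1 else 2, ?_⟩
  rw [isCubeRep_iff]
  intro u v huv
  constructor
  · intro hadj
    rw [pi_norm_le_iff_of_nonneg zero_le_one]
    intro k
    simp only [Pi.sub_apply, Real.norm_eq_abs]
    by_cases h1 : u = eq.symm k
    · have h2 : ¬ v = eq.symm k := fun h => huv (h1.trans h.symm)
      have h3 : G.Adj v (eq.symm k) := h1 ▸ hadj.symm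
      simp [h1, h2, h3]
    · by_cases h2 : v = eq.symm k
      · have h3 : G.Adj u (eq.symm k) := h2 ▸ hadj
        simp [h1, h2, h3]
      · simp only [h1, h2, if_false]
        split_ifs <;> norm_num
  · intro h
    by_contra hadj
    rw [pi_norm_le_iff_of_nonneg zero_le_one] at h
    have h1 := h (eq u)
    have h2 : ¬ G.Adj v u := fun h => hadj h.symm
    simp [huv.symm, h2] at h1

/-- `ρ(G) = max { log₂(|B(v,r)|/2) / log₂(2r+1) : v ∈ V, 1 ≤ r ≤ diam G }` for a finite connected
graph with at least two vertices (a finite nonempty set of reals, so `sSup` is its maximum); here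
`B(v,r)` is the set of vertices at distance at most `r` from `v`. -/
noncomputable def rho {V : Type u} (G : SimpleGraph V) : ℝ :=
  sSup {x : ℝ | ∃ (v : V) (r : ℕ), 1 ≤ r ∧ r ≤ G.diam ∧
    x = Real.logb 2 (({w : V | G.dist v w ≤ r}.ncard : ℝ) / 2) / Real.logb 2 (2 * (r : ℝ) + 1)}

/-- `t = ⌈22.77 ρ(G)⌉ + 2`. -/
noncomputable def tdim {V : Type u} (G : SimpleGraph V) : ℕ :=
  ⌈(22.77 : ℝ) * rho G⌉₊ + 2

/-! ### Weight-vector assignments -/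

/-- Weight-vector assignments `E(G) → [-1,1]^d`. -/
abbrev WeightAssignment {V : Type u} (G : SimpleGraph V) (d : ℕ) : Type u :=
  G.edgeSet → Fin d → Set.Icc (-1 : ℝ) 1

open Classical in
/-- The sum of the weight-vectors of the edges along the path of `G` from `a` to `b`
(used when `G` is a forest, where there is at most one such path). -/
noncomputable def pathSum {V : Type u} [Fintype V] (G : SimpleGraph V) {d : ℕ}
    (W : WeightAssignment G d) (a b : V) : Fin d → ℝ := fun k =>
  ∑ e ∈ Finset.univ.filter
    (fun e : G.edgeSet => ∃ p : G.Walk a b, p.IsPath ∧ (e : Sym2 V) ∈ p.edges), (W e k : ℝ)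

/-- `W` is separating for the pair `u, v` of vertices of the graph `G` with root `r`. -/
def Separates {V : Type u} [Fintype V] (G : SimpleGraph V) (r : V) {d : ℕ}
    (W : WeightAssignment G d) (u v : V) : Prop :=
  1 < ‖pathSum G W r u - pathSum G W r v‖

open Classical in
/-- View a weight-vector assignment of a subgraph `H` of `G` as one of `G`, by assigning the zero
vector to the other edges. -/
noncomputable def extendZero {V : Type u} {H : SimpleGraph V} (G : SimpleGraph V) {d : ℕ}
    (W : WeightAssignment H d) : WeightAssignment G d := fun e k =>
  if h : (e : Sym2 V) ∈ H.edgeSet then W ⟨e, h⟩ k else ⟨0, by norm_num⟩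

/-- Concatenation `W₀ ∘ W₁ ∘ W₂ ∘ W₃` of the components of four weight-vector assignments. -/
def concat4 {V : Type u} {G : SimpleGraph V} {t : ℕ} (W₀ W₁ W₂ W₃ : WeightAssignment G t) :
    WeightAssignment G (4 * t) := fun e k =>
  (![W₀, W₁, W₂, W₃] (finProdFinEquiv.symm k).1) e (finProdFinEquiv.symm k).2

/-! ### The recursive decomposition of a rooted tree -/

/-- Depth of `v` in the tree `T` with root `r`. -/
noncomputable def depth {V : Type u} (T : SimpleGraph V) (r v : V) : ℕ := T.dist r v

/-- Height of the rooted tree. -/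
noncomputable def height {V : Type u} [Fintype V] (T : SimpleGraph V) (r : V) : ℕ :=
  Finset.univ.sup (depth T r)

/-- `k = ⌈log₂ log₂ h⌉`, where `h` is the height. -/
noncomputable def kExp {V : Type u} [Fintype V] (T : SimpleGraph V) (r : V) : ℕ :=
  ⌈Real.logb 2 (Real.logb 2 (height T r : ℝ))⌉₊

/-- `h_i = Γ^(1/2^i)` with `Γ = 2^(2^k)`, that is, `h_i = 2^(2^(k-i))`; it is used for `i ≤ k`. -/
noncomputable def scale {V : Type u} [Fintype V] (T : SimpleGraph V) (r : V) (i : ℕ) : ℕ :=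
  2 ^ 2 ^ (kExp T r - i)

/-- The least even `e` with `h_e ≤ 2^16`. -/
noncomputable def evenIdx {V : Type u} [Fintype V] (T : SimpleGraph V) (r : V) : ℕ :=
  sInf {i : ℕ | Even i ∧ scale T r i ≤ 2 ^ 16}

/-- The least odd `o` with `h_o ≤ 2^16`. -/
noncomputable def oddIdx {V : Type u} [Fintype V] (T : SimpleGraph V) (r : V) : ℕ :=
  sInf {i : ℕ | Odd i ∧ scale T r i ≤ 2 ^ 16}

/-- The two kinds of decompositions. -/
inductive Side
  | A
  | B

/-- The edges between depths `j` and `j + 1` are deleted when `j` is a positive multiple of `3h`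
(kind `A`), resp. when `j ≡ h` modulo `3h` (kind `B`). -/
def IsCutDepth : Side → ℕ → ℕ → Prop
  | Side.A, h, j => 0 < j ∧ 3 * h ∣ j
  | Side.B, h, j => j ≡ h [MOD 3 * h]

/-- The set `O_i^X` of deleted edges at level `i`. -/
def cutEdges {V : Type u} [Fintype V] (T : SimpleGraph V) (r : V) (X : Side) (i : ℕ) :
    Set (Sym2 V) :=
  {e | ∃ u v : V, T.Adj u v ∧ e = s(u, v) ∧ depth T r v = depth T r u + 1 ∧
    IsCutDepth X (scale T r i) (depth T r u)}

/-- The forest left after the deletion: its edge set is `E(T) \ O_i^X`, and its connected components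
are the subtrees in the family `𝒜_i` (for `X = A`), resp. `ℬ_i` (for `X = B`). -/
def forest {V : Type u} [Fintype V] (T : SimpleGraph V) (r : V) (X : Side) (i : ℕ) :
    SimpleGraph V :=
  T.deleteEdges (cutEdges T r X i)

/-! ### The procedure -/

/-- `W` is obtained by combining, over all subtrees `F` of the level `i` decomposition of kind `X`,
the weight-vector assignments `W(uv) = f_F(u) - f_F(v)` (`u` the child of `v`) that correspond to
cube representations `f_F` of the subtrees `F`. -/
def IsBase {V : Type u} [Fintype V] (T : SimpleGraph V) (r : V) (X : Side) (i : ℕ) {t : ℕ}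
    (W : WeightAssignment (forest T r X i) t) : Prop :=
  ∀ F : (forest T r X i).ConnectedComponent, ∃ f : F → Fin t → ℝ,
    IsCubeRep F.toSimpleGraph f ∧
    ∀ (u v : F) (huv : (forest T r X i).Adj u v), depth T r u = depth T r v + 1 →
      ∀ k, (W ⟨s((u : V), (v : V)), huv⟩ k : ℝ) = f u k - f v k

/-- A bit read as an element of `{-1, 1}`. -/
def bitSign (b : Bool) : Set.Icc (-1 : ℝ) 1 :=
  if b then ⟨1, by norm_num⟩ else ⟨-1, by norm_num⟩

open Classical in
/-- The extension of an assignment `W` at level `i + 2` to level `i` that uses the bits `ω`: the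
edges in `E(T) \ O_{i+2}` keep their weight-vectors, and every edge of `O_{i+2} \ O_i` gets the
vector of `{-1, 1}^t` given by `ω`. -/
noncomputable def extend {V : Type u} [Fintype V] (T : SimpleGraph V) (r : V) (X : Side) (i : ℕ)
    {t : ℕ} (W : WeightAssignment (forest T r X (i + 2)) t)
    (ω : (forest T r X i).edgeSet → Fin t → Bool) : WeightAssignment (forest T r X i) t :=
  fun e k =>
    if h : (e : Sym2 V) ∈ (forest T r X (i + 2)).edgeSet then W ⟨e, h⟩ k else bitSign (ω e k)

/-- The check made for a subtree `F` of level `i`: with `S(v)` the sum of the weight-vectors along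
the path of `F` from the root `c` of `F` (its vertex of least depth) to `v`, one has
`‖S(u) - S(v)‖ > 1` for all pairs of non-adjacent vertices of `F` at distance at least
`h_{i+1}`. -/
def Accepts {V : Type u} [Fintype V] (T : SimpleGraph V) (r : V) (X : Side) (i : ℕ) {t : ℕ}
    (W : WeightAssignment (forest T r X i) t) (F : (forest T r X i).ConnectedComponent) : Prop :=
  ∀ c ∈ F.supp, (∀ w ∈ F.supp, depth T r c ≤ depth T r w) →
    ∀ u ∈ F.supp, ∀ v ∈ F.supp, u ≠ v → ¬ (forest T r X i).Adj u v →
      scale T r (i + 1) ≤ T.dist u v →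
        1 < ‖pathSum (forest T r X i) W c u - pathSum (forest T r X i) W c v‖

/-- A (completed) run of the procedure on the tree `T` with root `r`: the assignments
`W_i^X : E(T) \ O_i^X → [-1,1]^t` for `i ≤ max e o` (the values for other `i` play no role). -/
structure ProcedureRun {V : Type u} [Fintype V] (T : SimpleGraph V) (r : V) where
  W : ∀ (X : Side) (i : ℕ), WeightAssignment (forest T r X i) (tdim T)
  base_even : ∀ X, IsBase T r X (evenIdx T r) (W X (evenIdx T r))
  base_odd : ∀ X, IsBase T r X (oddIdx T r) (W X (oddIdx T r))
  step : ∀ (X : Side) (i : ℕ), i + 2 ≤ max (evenIdx T r) (oddIdx T r) →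
    (∃ ω, W X i = extend T r X i (W X (i + 2)) ω) ∧ ∀ F, Accepts T r X i (W X i) F

/-- The output `W_0^A ∘ W_0^B ∘ W'_0^A ∘ W'_0^B` of a run, where `W'_0^X` agrees with `W_1^X` on
`E(T) \ O_1^X` and vanishes on `O_1^X`. (No edge is deleted at level `0`, so `W_0^X` is defined on
all of `E(T)`.) -/
noncomputable def ProcedureRun.output {V : Type u} [Fintype V] {T : SimpleGraph V} {r : V}
    (R : ProcedureRun T r) : WeightAssignment T (4 * tdim T) :=
  concat4 (extendZero T (R.W Side.A 0)) (extendZero T (R.W Side.B 0))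
    (extendZero T (R.W Side.A 1)) (extendZero T (R.W Side.B 1))

theorem le_two_pow_two_pow (h : ℕ) : h ≤ 2 ^ 2 ^ ⌈Real.logb 2 (Real.logb 2 (h : ℝ))⌉₊ := by
  rcases Nat.lt_or_ge h 2 with h2 | h2
  · exact (Nat.le_of_lt_succ h2).trans Nat.one_le_two_pow
  · have hh : (2 : ℝ) ≤ h := by exact_mod_cast h2
    have hpos : 0 < Real.logb 2 (h : ℝ) := Real.logb_pos (by norm_num) (by linarith)
    have h3 : Real.logb 2 (h : ℝ) ≤ (2 : ℝ) ^ (⌈Real.logb 2 (Real.logb 2 (h : ℝ))⌉₊ : ℝ) :=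
      (Real.logb_le_iff_le_rpow (by norm_num) hpos).1 (Nat.le_ceil _)
    have h4 : (h : ℝ) ≤ (2 : ℝ) ^ ((2 : ℝ) ^ (⌈Real.logb 2 (Real.logb 2 (h : ℝ))⌉₊ : ℝ)) :=
      (Real.logb_le_iff_le_rpow (by norm_num) (by linarith)).1 h3
    rw [Real.rpow_natCast] at h4
    have h5 : (2 : ℝ) ^ ⌈Real.logb 2 (Real.logb 2 (h : ℝ))⌉₊
        = ((2 ^ ⌈Real.logb 2 (Real.logb 2 (h : ℝ))⌉₊ : ℕ) : ℝ) := by push_cast; rfl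
    rw [h5, Real.rpow_natCast] at h4
    exact_mod_cast h4

/-- No edge is deleted at level `0`. -/
theorem forest_zero {V : Type u} [Fintype V] (T : SimpleGraph V) (r : V) (X : Side) :
    forest T r X 0 = T := by
  have hs : height T r ≤ scale T r 0 := le_two_pow_two_pow _
  have hpos : 0 < scale T r 0 := by unfold scale; positivity
  have : cutEdges T r X 0 = ∅ := by
    ext e
    simp only [cutEdges, Set.mem_ofPred_eq, Set.mem_empty_iff_false, iff_false]
    rintro ⟨u, v, -, -, hd, hc⟩
    have hv : depth T r v ≤ height T r := Finset.le_sup (f := depth T r) (Finset.mem_univ v)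
    have hlt : depth T r u < scale T r 0 := by omega
    cases X with
    | A => exact absurd (Nat.le_of_dvd hc.1 hc.2) (by omega)
    | B =>
      have h1 : depth T r u % (3 * scale T r 0) = scale T r 0 % (3 * scale T r 0) := hc
      rw [Nat.mod_eq_of_lt (by omega), Nat.mod_eq_of_lt (by omega)] at h1
      omega
  rw [forest, this, SimpleGraph.deleteEdges_empty]

end TreeCubicity

namespace TreeCubicity

/-! ### Parents and ancestors in a rooted tree -/

section Ancestors

variable {V : Type u} {T : SimpleGraph V} {r : V}

/-! The difference of two vertex sums only involves the edges of the path joining the two vertices.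
Adjacent vertices thus differ by a single vector of `[-1,1]^d`, and the sums are cube centres as
soon as every non-adjacent pair is separated.

Cut depths of the two kinds at level `i` are at least `h_i` apart (`cutDepth_gap`), so a path of
length at most `h_i` avoids the cuts of one kind and its ends share a component
(`exists_forest_reachable`). Let `m` be the first level with `h_m ≤ 2^16`; then `e` and `o` are `m`
and `m + 1` in some order. Pairs at distance at most `h_m`, and all pairs if `m = 0`, are separated
by a cube representation of a level-`m` component. A farther pair with `h_{i+1} ≤ dist ≤ h_i`, or
beyond `h_0` with `i = 0`, is separated by the check at level `i`. Extensions keep earlier vectors,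
so the separation survives in the output block whose kind and parity are those of `i`
(`ProcedureRun.separates`).

Base representations exist because a component at these levels is a graded forest with at most
`2(6·2^16+1)^ρ` vertices, and a graded forest on at most `2^d` vertices fits in dimension `d + 1`:
one coordinate for the grade, one for each bit of a numbering (`exists_isCubeRep_of_graded`).

A random extension is accepted with good probability by a union bound (`extend_accepts_prob`). With
`q = h_{i+2}`, a path of length at least `2^j q^2` crosses at least `m` random edges, where `3m ≥
2^j(q-6)`. Each coordinate of the difference is a constant plus `m` independent signs, and lies in
`[-1,1]` with probability at most `x^{1/2}`, `x = 8/(2^j(q-6))`. Over `t ≥ 22ρ+2` coordinates this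
gives `x · x^{11ρ}`, and the factor `x^{11ρ}` pays for the number of pairs in the dyadic distance
class, which `ρ` bounds. What remains is at most `4x`, summable in `j`. Acceptance in a component
depends only on its own edges, so good choices for all components can be glued
(`exists_extend_accepts`). -/

theorem depth_adj (hT : T.IsTree) (r : V) {u v : V} (h : T.Adj u v) :
    depth T r v = depth T r u + 1 ∨ depth T r u = depth T r v + 1 := by
  have := hT.dist_eq_dist_add_one_of_adj r h
  unfold depth
  tauto

theorem exists_parent (hT : T.IsTree) {r v : V} (hv : depth T r v ≠ 0) :
    ∃ u, T.Adj u v ∧ depth T r v = depth T r u + 1 := by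
  obtain ⟨p, hp⟩ := hT.connected.exists_walk_length_eq_dist v r
  cases p with
  | nil => simp [depth] at hv
  | cons h q =>
    rename_i w
    refine ⟨w, h.symm, ?_⟩
    have h1 : T.dist w r ≤ q.length := SimpleGraph.dist_le q
    rw [SimpleGraph.Walk.length_cons] at hp
    rcases depth_adj hT r h with h2 | h2
    · unfold depth at *
      rw [T.dist_comm (u := v)] at hp
      rw [T.dist_comm (u := w)] at h1
      omega
    · exact h2

/-- A geodesic from the root to either parent, prolonged by the last edge, is a path to `v`; a tree
has only one such path, hence one penultimate vertex. -/
theorem parent_unique (hT : T.IsTree) {r u u' v : V} (h : T.Adj u v) (h' : T.Adj u' v)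
    (hd : depth T r v = depth T r u + 1) (hd' : depth T r v = depth T r u' + 1) : u = u' := by
  have key : ∀ w, T.Adj w v → depth T r v = depth T r w + 1 →
      ∃ p : T.Walk r v, p.IsPath ∧ p.penultimate = w := by
    intro w hw hdw
    obtain ⟨p, hp⟩ := hT.connected.exists_walk_length_eq_dist r w
    refine ⟨p.concat hw, SimpleGraph.Walk.isPath_of_length_eq_dist _ ?_, by simp⟩
    rw [SimpleGraph.Walk.length_concat, hp]
    exact hdw.symm
  obtain ⟨p, hp, rfl⟩ := key u h hd
  obtain ⟨p', hp', rfl⟩ := key u' h' hd'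
  rw [(hT.existsUnique_path r v).unique hp hp']

open Classical in
/-- The parent of `v` in the tree `T` with root `r` (the root is its own parent). -/
noncomputable def par (T : SimpleGraph V) (r v : V) : V :=
  if h : ∃ u, T.Adj u v ∧ depth T r v = depth T r u + 1 then h.choose else v

theorem par_eq (hT : T.IsTree) {u v : V} (h : T.Adj u v) (hd : depth T r v = depth T r u + 1) :
    par T r v = u := by
  have hex : ∃ u, T.Adj u v ∧ depth T r v = depth T r u + 1 := ⟨u, h, hd⟩
  rw [par, dif_pos hex]
  exact parent_unique hT hex.choose_spec.1 h hex.choose_spec.2 hd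

theorem par_adj (hT : T.IsTree) {v : V} (hv : depth T r v ≠ 0) : T.Adj (par T r v) v := by
  have hex := exists_parent hT hv
  rw [par, dif_pos hex]
  exact hex.choose_spec.1

theorem depth_par (hT : T.IsTree) {v : V} (hv : depth T r v ≠ 0) :
    depth T r v = depth T r (par T r v) + 1 := by
  have hex := exists_parent hT hv
  rw [par, dif_pos hex]
  exact hex.choose_spec.2

/-- The ancestor of `v` at depth `j`. -/
noncomputable def anc (T : SimpleGraph V) (r v : V) (j : ℕ) : V :=
  (par T r)^[depth T r v - j] v

@[simp]
theorem anc_depth (v : V) : anc T r v (depth T r v) = v := by simp [anc]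

theorem depth_iterate_par (hT : T.IsTree) (v : V) (n : ℕ) (hn : n ≤ depth T r v) :
    depth T r ((par T r)^[n] v) = depth T r v - n := by
  induction n with
  | zero => simp
  | succ n ih =>
    have h := ih (by omega)
    rw [Function.iterate_succ_apply']
    have := depth_par (r := r) hT (v := (par T r)^[n] v) (by omega)
    omega

theorem depth_anc (hT : T.IsTree) {v : V} {j : ℕ} (hj : j ≤ depth T r v) :
    depth T r (anc T r v j) = j := by
  rw [anc, depth_iterate_par hT _ _ (by omega)]
  omega

theorem par_anc {v : V} {j : ℕ} (hj : j < depth T r v) :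
    par T r (anc T r v (j + 1)) = anc T r v j := by
  rw [anc, anc, ← Function.iterate_succ_apply' (par T r)]
  congr 1
  omega

theorem anc_anc (hT : T.IsTree) {v : V} {i j : ℕ} (hij : i ≤ j) (hj : j ≤ depth T r v) :
    anc T r (anc T r v j) i = anc T r v i := by
  have h := depth_anc hT hj
  rw [anc, h, anc, anc, ← Function.iterate_add_apply]
  congr 1
  omega

theorem anc_par {v : V} (hT : T.IsTree) (hv : depth T r v ≠ 0) {j : ℕ} (hj : j < depth T r v) :
    anc T r (par T r v) j = anc T r v j := by
  have h := depth_par (r := r) hT hv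
  rw [anc, anc, ← Function.iterate_succ_apply]
  congr 1
  omega

theorem anc_adj (hT : T.IsTree) {v : V} {j : ℕ} (hj : j < depth T r v) :
    T.Adj (anc T r v j) (anc T r v (j + 1)) := by
  rw [← par_anc hj]
  apply par_adj hT
  rw [depth_anc hT (by omega)]
  omega

theorem depth_root : depth T r r = 0 := by simp [depth]

theorem eq_root_of_depth (hT : T.IsTree) {v : V} (h : depth T r v = 0) : v = r :=
  ((hT.connected.dist_eq_zero_iff).1 h).symm

theorem depth_le_add_dist (hT : T.IsTree) (u v : V) :
    depth T r v ≤ depth T r u + T.dist u v :=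
  hT.connected.dist_triangle

theorem dist_anc_le (hT : T.IsTree) {v : V} {j : ℕ} (hj : j ≤ depth T r v) :
    T.dist (anc T r v j) v ≤ depth T r v - j := by
  induction h : depth T r v - j generalizing j with
  | zero =>
    obtain rfl : j = depth T r v := by omega
    simp
  | succ n ih =>
    have h1 := ih (j := j + 1) (by omega) (by omega)
    have h2 : T.dist (anc T r v j) (anc T r v (j + 1)) = 1 :=
      SimpleGraph.dist_eq_one_iff_adj.2 (anc_adj hT (by omega))
    have := hT.connected.dist_triangle (u := anc T r v j) (v := anc T r v (j + 1)) (w := v)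
    omega

/-- The depth at which the paths from the root to `u` and `v` branch. -/
theorem exists_branch (hT : T.IsTree) (r u v : V) :
    ∃ a, a ≤ depth T r u ∧ a ≤ depth T r v ∧ (∀ j ≤ a, anc T r u j = anc T r v j) ∧
      (∀ j, a < j → j ≤ depth T r u → j ≤ depth T r v → anc T r u j ≠ anc T r v j) ∧
      T.dist u v ≤ (depth T r u - a) + (depth T r v - a) := by
  classical
  let P : ℕ → Prop := fun j => j ≤ depth T r v ∧ anc T r u j = anc T r v j
  have h0 : P 0 := by
    refine ⟨Nat.zero_le _, ?_⟩
    rw [eq_root_of_depth hT (depth_anc hT (v := u) (Nat.zero_le _)),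
      eq_root_of_depth hT (depth_anc hT (v := v) (Nat.zero_le _))]
  -- The depth of the deepest common ancestor.
  let a := Nat.findGreatest P (depth T r u)
  have ha : P a := Nat.findGreatest_spec (P := P) (Nat.zero_le _) h0
  have hau : a ≤ depth T r u := Nat.findGreatest_le _
  refine ⟨a, hau, ha.1, ?_, ?_, ?_⟩
  · intro j hj
    rw [← anc_anc hT hj hau, ha.2, anc_anc hT hj ha.1]
  · intro j haj hju hjv h
    exact Nat.findGreatest_is_greatest haj hju ⟨hjv, h⟩
  · have h1 := dist_anc_le hT hau
    have h2 := dist_anc_le hT ha.1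
    rw [T.dist_comm] at h1
    rw [← ha.2] at h2
    have := hT.connected.dist_triangle (u := u) (v := anc T r u a) (w := v)
    omega

/-! ### Monotone paths and path sums -/

/-- A path that has stepped down can never turn up again: it would have to go to the unique parent,
which it has just left. -/
theorem depth_end_of_isPath_cons (hT : T.IsTree) {x y z : V} (h : T.Adj x y) (p : T.Walk y z)
    (hp : (SimpleGraph.Walk.cons h p).IsPath) (hd : depth T r y = depth T r x + 1) :
    depth T r z = depth T r y + p.length := by
  induction p generalizing x with
  | nil => simp
  | @cons y w z h' q ih =>
    rw [SimpleGraph.Walk.cons_isPath_iff] at hp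
    have hw : depth T r w = depth T r y + 1 := by
      rcases depth_adj hT r h' with h1 | h1
      · exact h1
      · exfalso
        apply hp.2
        rw [parent_unique hT h h'.symm hd h1]
        simp
    rw [ih h' hp.1 hw, SimpleGraph.Walk.length_cons]
    omega

theorem depth_end_of_isPath (hT : T.IsTree) {c u : V} (p : T.Walk c u) (hp : p.IsPath)
    (hc : ∀ w ∈ p.support, depth T r c ≤ depth T r w) :
    depth T r u = depth T r c + p.length := by
  cases p with
  | nil => simp
  | @cons _ y _ h q =>
    have hy : depth T r y = depth T r c + 1 := by
      rcases depth_adj hT r h with h1 | h1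
      · exact h1
      · have := hc y (by simp)
        omega
    rw [depth_end_of_isPath_cons hT h q hp hy, SimpleGraph.Walk.length_cons]
    omega

/-- Depth changes by one along each edge, so a walk as long as the drop in depth must step to the
parent every time. Its edges are then indexed by the depths of their lower ends. -/
theorem mem_edges_of_depth (hT : T.IsTree) {u c : V} (p : T.Walk u c)
    (hp : depth T r u = depth T r c + p.length) :
    anc T r u (depth T r c) = c ∧ ∀ e, e ∈ p.edges ↔
      ∃ j, depth T r c < j ∧ j ≤ depth T r u ∧ e = s(par T r (anc T r u j), anc T r u j) := by
  induction p with
  | nil =>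
    refine ⟨anc_depth _, fun e => ?_⟩
    simp only [SimpleGraph.Walk.edges_nil, List.not_mem_nil, false_iff]
    rintro ⟨j, h1, h2, -⟩
    omega
  | @cons u w c h q ih =>
    rw [SimpleGraph.Walk.length_cons] at hp
    have h1 : depth T r w ≤ depth T r c + q.length := by
      have h2 := depth_le_add_dist hT (r := r) c w
      have h3 : T.dist c w ≤ q.reverse.length := SimpleGraph.dist_le _
      rw [SimpleGraph.Walk.length_reverse] at h3
      omega
    have hw : depth T r u = depth T r w + 1 := by
      rcases depth_adj hT r h with h2 | h2 <;> omega
    have hpar : par T r u = w := par_eq hT h.symm hw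
    have hu0 : depth T r u ≠ 0 := by omega
    obtain ⟨ih1, ih2⟩ := ih (by omega)
    have hanc : ∀ j, j < depth T r u → anc T r w j = anc T r u j := by
      intro j hj
      rw [← hpar]
      exact anc_par hT hu0 hj
    refine ⟨by rw [← hanc _ (by omega), ih1], fun e => ?_⟩
    rw [SimpleGraph.Walk.edges_cons, List.mem_cons, ih2]
    constructor
    · rintro (rfl | ⟨j, h1, h2, rfl⟩)
      · refine ⟨depth T r u, by omega, le_rfl, ?_⟩
        rw [anc_depth, hpar, Sym2.eq_swap]
      · exact ⟨j, h1, by omega, by rw [hanc _ (by omega)]⟩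
    · rintro ⟨j, h1, h2, rfl⟩
      rcases h2.eq_or_lt with rfl | h2
      · left
        rw [anc_depth, hpar, Sym2.eq_swap]
      · right
        exact ⟨j, h1, by omega, by rw [hanc _ (by omega)]⟩

end Ancestors

/-! ### Components of a subforest, their top vertices, and path sums along ancestors -/

/-- The edge joining the ancestor of `u` at depth `j` to its parent. -/
noncomputable def ancEdge {V : Type u} (T : SimpleGraph V) (r u : V) (j : ℕ) : Sym2 V :=
  s(par T r (anc T r u j), anc T r u j)

/-- `c` is a vertex of least depth of the component `F` of the subgraph `G` of `T`. -/
def IsTop {V : Type u} (T : SimpleGraph V) (r : V) {G : SimpleGraph V} (F : G.ConnectedComponent)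
    (c : V) : Prop :=
  c ∈ F.supp ∧ ∀ w ∈ F.supp, depth T r c ≤ depth T r w

section Top

variable {V : Type u} {T : SimpleGraph V} {r : V} {G : SimpleGraph V} {F : G.ConnectedComponent}

theorem exists_isTop (T : SimpleGraph V) (r : V) (F : G.ConnectedComponent) :
    ∃ c, IsTop T r F c := by
  obtain ⟨c, hc, hmin⟩ := (measure (depth T r)).wf.has_min F.supp F.nonempty_supp
  exact ⟨c, hc, fun w hw => not_lt.1 (hmin w hw)⟩

/-- The first step of a path leaving a vertex of least depth goes down, and hence so do all the
others. -/
theorem IsTop.path_depth (hT : T.IsTree) (hG : G ≤ T) {c u : V} (hc : IsTop T r F c)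
    (p : G.Walk c u) (hp : p.IsPath) : depth T r u = depth T r c + p.length := by
  classical
  have h := depth_end_of_isPath (r := r) hT (p.mapLe hG) (by simpa using hp) ?_
  · simpa using h
  · intro w hw
    apply hc.2
    have hw' : w ∈ p.support := by simpa using hw
    have : G.Reachable c w := ⟨p.takeUntil w hw'⟩
    rw [SimpleGraph.ConnectedComponent.mem_supp_iff, ← hc.1]
    exact SimpleGraph.ConnectedComponent.sound this.symm

theorem IsTop.exists_path (hc : IsTop T r F c) {u : V} (hu : u ∈ F.supp) :
    ∃ p : G.Walk c u, p.IsPath := by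
  classical
  obtain ⟨p⟩ := F.reachable_of_mem_supp hc.1 hu
  exact ⟨p.bypass, p.bypass_isPath⟩

theorem IsTop.mem_edges_iff (hT : T.IsTree) (hG : G ≤ T) {c u : V} (hc : IsTop T r F c)
    (p : G.Walk c u) (hp : p.IsPath) (e : Sym2 V) :
    e ∈ p.edges ↔ ∃ j, depth T r c < j ∧ j ≤ depth T r u ∧ e = ancEdge T r u j := by
  have h := hc.path_depth hT hG p hp
  have h2 := (mem_edges_of_depth hT (r := r) (p.reverse.mapLe hG) (by simpa using h)).2 e
  simpa [ancEdge] using h2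

theorem IsTop.anc_eq (hT : T.IsTree) (hG : G ≤ T) {c u : V} (hc : IsTop T r F c)
    (hu : u ∈ F.supp) : depth T r c ≤ depth T r u ∧ anc T r u (depth T r c) = c := by
  obtain ⟨p, hp⟩ := hc.exists_path hu
  have h := hc.path_depth hT hG p hp
  exact ⟨by omega, (mem_edges_of_depth hT (r := r) (p.reverse.mapLe hG) (by simpa using h)).1⟩

theorem IsTop.ancEdge_mem (hT : T.IsTree) (hG : G ≤ T) {c u : V} (hc : IsTop T r F c)
    (hu : u ∈ F.supp) {j : ℕ} (h1 : depth T r c < j) (h2 : j ≤ depth T r u) :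
    ancEdge T r u j ∈ G.edgeSet := by
  obtain ⟨p, hp⟩ := hc.exists_path hu
  exact p.edges_subset_edgeSet ((hc.mem_edges_iff hT hG p hp _).2 ⟨j, h1, h2, rfl⟩)

theorem IsTop.anc_mem (hT : T.IsTree) (hG : G ≤ T) {c u : V} (hc : IsTop T r F c)
    (hu : u ∈ F.supp) {j : ℕ} (h1 : depth T r c ≤ j) (h2 : j ≤ depth T r u) :
    anc T r u j ∈ F.supp := by
  induction h : depth T r u - j generalizing j with
  | zero =>
    obtain rfl : j = depth T r u := by omega
    simpa using hu
  | succ n ih =>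
    have h3 := ih (j := j + 1) (by omega) (by omega) (by omega)
    have h4 := hc.ancEdge_mem hT hG hu (j := j + 1) (by omega) (by omega)
    rw [ancEdge, par_anc (by omega), SimpleGraph.mem_edgeSet] at h4
    exact F.mem_supp_of_adj_mem_supp h3 h4.symm

theorem IsTop.unique (hT : T.IsTree) (hG : G ≤ T) {c c' : V} (hc : IsTop T r F c)
    (hc' : IsTop T r F c') : c = c' := by
  have h := (hc.anc_eq hT hG hc'.1).2
  rw [le_antisymm (hc.2 _ hc'.1) (hc'.2 _ hc.1), anc_depth] at h
  exact h.symm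

theorem ancEdge_eq_iff (hT : T.IsTree) {u v : V} {i j : ℕ} (hi : 0 < i) (hj : 0 < j)
    (hiu : i ≤ depth T r u) (hjv : j ≤ depth T r v) :
    ancEdge T r u i = ancEdge T r v j ↔ i = j ∧ anc T r u i = anc T r v j := by
  constructor
  · intro h
    have h1 := depth_anc hT hiu
    have h2 := depth_anc hT hjv
    have h3 := depth_par (r := r) hT (v := anc T r u i) (by omega)
    have h4 := depth_par (r := r) hT (v := anc T r v j) (by omega)
    rw [ancEdge, ancEdge, Sym2.eq_iff] at h
    rcases h with ⟨h5, h6⟩ | ⟨h5, h6⟩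
    · exact ⟨by rw [← h1, h6, h2], h6⟩
    · rw [h5] at h3
      rw [← h6] at h4
      omega
  · rintro ⟨rfl, h⟩
    rw [ancEdge, ancEdge, h]

open Classical in
/-- The value of `W` on an arbitrary unordered pair, `0` for a non-edge. -/
noncomputable def ext0 {d : ℕ} (W : WeightAssignment G d) (e : Sym2 V) (k : Fin d) : ℝ :=
  if h : e ∈ G.edgeSet then W ⟨e, h⟩ k else 0

theorem ext0_of_mem {d : ℕ} (W : WeightAssignment G d) {e : Sym2 V} (h : e ∈ G.edgeSet)
    (k : Fin d) : ext0 W e k = W ⟨e, h⟩ k := by rw [ext0, dif_pos h]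

theorem IsTop.exists_path_mem_iff (hT : T.IsTree) (hG : G ≤ T) {c u : V} (hc : IsTop T r F c)
    (hu : u ∈ F.supp) (e : Sym2 V) :
    (∃ p : G.Walk c u, p.IsPath ∧ e ∈ p.edges) ↔
      ∃ j, depth T r c < j ∧ j ≤ depth T r u ∧ e = ancEdge T r u j := by
  constructor
  · rintro ⟨p, hp, he⟩
    exact (hc.mem_edges_iff hT hG p hp e).1 he
  · intro h
    obtain ⟨p, hp⟩ := hc.exists_path hu
    exact ⟨p, hp, (hc.mem_edges_iff hT hG p hp e).2 h⟩

theorem IsTop.sum_filter_ancEdge [Fintype G.edgeSet] (hT : T.IsTree) (hG : G ≤ T) {c u : V}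
    (hc : IsTop T r F c) (hu : u ∈ F.supp) {d : ℕ} (W : WeightAssignment G d) (k : Fin d) {a : ℕ}
    (hca : depth T r c ≤ a)
    [DecidablePred fun e : G.edgeSet => ∃ j, a < j ∧ j ≤ depth T r u ∧ (e : Sym2 V) =
      ancEdge T r u j] :
    ∑ j ∈ Finset.Ioc a (depth T r u), ext0 W (ancEdge T r u j) k =
      ∑ e ∈ Finset.univ.filter (fun e : G.edgeSet => ∃ j, a < j ∧ j ≤ depth T r u ∧
        (e : Sym2 V) = ancEdge T r u j), (W e k : ℝ) := by
  refine Finset.sum_bij (fun j hj => (⟨ancEdge T r u j, hc.ancEdge_mem hT hG hu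
    (hca.trans_lt (Finset.mem_Ioc.1 hj).1) (Finset.mem_Ioc.1 hj).2⟩ : G.edgeSet)) ?_ ?_ ?_ ?_
  · intro j hj
    rw [Finset.mem_Ioc] at hj
    rw [Finset.mem_filter]
    exact ⟨Finset.mem_univ _, j, hj.1, hj.2, rfl⟩
  · intro i hi j hj h
    rw [Finset.mem_Ioc] at hi hj
    rw [Subtype.mk.injEq, ancEdge_eq_iff hT (by omega) (by omega) hi.2 hj.2] at h
    exact h.1
  · rintro ⟨e, he⟩ h
    rw [Finset.mem_filter] at h
    obtain ⟨j, h1, h2, h3⟩ := h.2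
    exact ⟨j, Finset.mem_Ioc.2 ⟨h1, h2⟩, Subtype.ext h3.symm⟩
  · intro j hj
    exact ext0_of_mem W _ k

theorem IsTop.pathSum_eq [Fintype V] (hT : T.IsTree) (hG : G ≤ T) {c u : V} (hc : IsTop T r F c)
    (hu : u ∈ F.supp) {d : ℕ} (W : WeightAssignment G d) (k : Fin d) :
    pathSum G W c u k =
      ∑ j ∈ Finset.Ioc (depth T r c) (depth T r u), ext0 W (ancEdge T r u j) k := by
  classical
  rw [hc.sum_filter_ancEdge hT hG hu W k le_rfl]
  exact Finset.sum_congr (Finset.filter_congr fun e _ => hc.exists_path_mem_iff hT hG hu e)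
    fun _ _ => rfl

/-- The edges above the branching depth `a` are common to both paths and cancel. -/
theorem IsTop.pathSum_sub [Fintype V] (hT : T.IsTree) (hG : G ≤ T) {c u v : V}
    (hc : IsTop T r F c) (hu : u ∈ F.supp) (hv : v ∈ F.supp) {d : ℕ} (W : WeightAssignment G d)
    (k : Fin d) {a : ℕ} (hca : depth T r c ≤ a) (hau : a ≤ depth T r u) (hav : a ≤ depth T r v)
    (h : ∀ j ≤ a, anc T r u j = anc T r v j) :
    pathSum G W c u k - pathSum G W c v k =
      ∑ j ∈ Finset.Ioc a (depth T r u), ext0 W (ancEdge T r u j) k -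
      ∑ j ∈ Finset.Ioc a (depth T r v), ext0 W (ancEdge T r v j) k := by
  rw [hc.pathSum_eq hT hG hu, hc.pathSum_eq hT hG hv,
    ← Finset.sum_Ioc_consecutive _ hca hau, ← Finset.sum_Ioc_consecutive _ hca hav]
  have : ∑ j ∈ Finset.Ioc (depth T r c) a, ext0 W (ancEdge T r u j) k =
      ∑ j ∈ Finset.Ioc (depth T r c) a, ext0 W (ancEdge T r v j) k := by
    refine Finset.sum_congr rfl fun j hj => ?_
    rw [ancEdge, ancEdge, h j (Finset.mem_Ioc.1 hj).2]
  rw [this]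
  ring

end Top

/-! ### Cube representations of graded forests -/

section GradedForest

/-- A preorder-like numbering: the intervals `[l v, R v]` of a child and its parent intersect, and
those of other pairs of vertices whose grades differ by at most one are disjoint. -/
theorem exists_interval_numbering {V : Type u} (G : SimpleGraph V) (δ : V → ℕ)
    (hadj : ∀ u v, G.Adj u v → δ v = δ u + 1 ∨ δ u = δ v + 1)
    (huniq : ∀ u u' v, G.Adj u v → G.Adj u' v → δ v = δ u + 1 → δ v = δ u' + 1 → u = u')
    (S : Finset V) :
    ∃ l R : V → ℕ, (∀ u ∈ S, l u ≤ R u ∧ R u < S.card) ∧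
      (∀ u ∈ S, ∀ v ∈ S, G.Adj u v → δ v = δ u + 1 → l u < l v ∧ l v ≤ R u) ∧
      (∀ u ∈ S, ∀ v ∈ S, u ≠ v → ¬ G.Adj u v → δ u ≤ δ v + 1 → δ v ≤ δ u + 1 →
        R u < l v ∨ R v < l u) := by
  classical
  induction S using Finset.induction_on_max_value δ with
  | empty => exact ⟨fun _ => 0, fun _ => 0, by simp⟩
  | insert x S hx hmax ih =>
    obtain ⟨l, R, h1, h2, h3⟩ := ih
    have hne : ∀ u ∈ S, u ≠ x := fun u hu h => hx (h ▸ hu)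
    have hxx : ¬ G.Adj x x := G.irrefl
    -- The new vertex `x` has the largest grade, so its only possible neighbour in `S` is its
    -- parent. It receives a one-point interval: right after the left end of the parent if there is
    -- one, otherwise after all numbers in use.
    by_cases hp : ∃ p ∈ S, G.Adj p x ∧ δ x = δ p + 1
    · obtain ⟨p, hpS, hpx, hδ⟩ := hp
      -- Room is made at `l p + 1`. Left ends equal to `l p` stay, while right ends equal to `l p`
      -- move, so that the interval of `p` always stretches over the new point.
      let σ : ℕ → ℕ := fun y => if y ≤ l p then y else y + 1
      let τ : ℕ → ℕ := fun y => if y < l p then y else y + 1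
      have hσ : ∀ y z, y < z → σ y < σ z := by
        intro y z h; simp only [σ]; split_ifs <;> omega
      have hστ : ∀ y z, y ≤ z → σ y ≤ τ z := by
        intro y z h; simp only [σ, τ]; split_ifs <;> omega
      have hτσ : ∀ y z, y < z → τ y < σ z := by
        intro y z h; simp only [σ, τ]; split_ifs <;> omega
      have hτ : ∀ y, τ y ≤ y + 1 := by
        intro y; simp only [τ]; split_ifs <;> omega
      have hnew : ∀ u ∈ S, ¬ G.Adj u x → δ x ≤ δ u + 1 → τ (R u) < l p + 1 ∨ l p + 1 < σ (l u) := by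
        intro u hu hux hd
        have hup : u ≠ p := fun h => hux (h ▸ hpx)
        -- If `u` is a sibling of `x`, its left end already lies beyond `l p`; otherwise its
        -- interval misses that of `p`, and with it the new point.
        by_cases hadj' : G.Adj p u
        · have hdu : δ u = δ p + 1 := by
            rcases hadj p u hadj' with h | h
            · exact h
            · have := hmax u hu; omega
          have := (h2 p hpS u hu hadj' hdu).1
          right
          simp only [σ]; split_ifs <;> omega
        · have hle := hmax u hu
          rcases h3 u hu p hpS hup (fun h => hadj' h.symm) (by omega) (by omega) with h | h
          · left
            simp only [τ]; split_ifs; omega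
          · right
            have := (h1 p hpS).1
            simp only [σ]; split_ifs <;> omega
      refine ⟨fun y => if y = x then l p + 1 else σ (l y),
        fun y => if y = x then l p + 1 else τ (R y), ?_, ?_, ?_⟩
      · intro u hu
        rw [Finset.card_insert_of_notMem hx]
        rcases Finset.mem_insert.1 hu with rfl | hu
        · simp only [if_true]
          have := h1 p hpS
          omega
        · simp only [hne u hu, if_false]
          have := h1 u hu
          have := hστ _ _ this.1
          have := hτ (R u)
          omega
      · intro u hu v hv huv hd
        rw [Finset.mem_insert] at hu hv
        rcases hu with rfl | hu <;> rcases hv with rfl | hv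
        · exact absurd huv hxx
        · have := hmax v hv
          omega
        · obtain rfl := huniq u p v huv hpx hd hδ
          simp only [hne u hu, if_false, if_true]
          have := h1 u hpS
          simp only [σ, τ]; split_ifs <;> omega
        · simp only [hne u hu, hne v hv, if_false]
          have := h2 u hu v hv huv hd
          exact ⟨hσ _ _ this.1, hστ _ _ this.2⟩
      · intro u hu v hv huv hn hd1 hd2
        rw [Finset.mem_insert] at hu hv
        rcases hu with rfl | hu <;> rcases hv with rfl | hv
        · exact absurd rfl huv
        · simp only [hne v hv, if_false, if_true]
          exact (hnew v hv (fun h => hn h.symm) hd1).symm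
        · simp only [hne u hu, if_false, if_true]
          exact hnew u hu hn hd2
        · simp only [hne u hu, hne v hv, if_false]
          rcases h3 u hu v hv huv hn hd1 hd2 with h | h
          · exact Or.inl (hτσ _ _ h)
          · exact Or.inr (hτσ _ _ h)
    · refine ⟨fun y => if y = x then S.card else l y, fun y => if y = x then S.card else R y,
        ?_, ?_, ?_⟩
      · intro u hu
        rw [Finset.card_insert_of_notMem hx]
        rcases Finset.mem_insert.1 hu with rfl | hu
        · simp
        · simp only [hne u hu, if_false]
          have := h1 u hu
          omega
      · intro u hu v hv huv hd
        rw [Finset.mem_insert] at hu hv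
        rcases hu with rfl | hu <;> rcases hv with rfl | hv
        · exact absurd huv hxx
        · have := hmax v hv
          omega
        · exact absurd ⟨u, hu, huv, hd⟩ hp
        · simp only [hne u hu, hne v hv, if_false]
          exact h2 u hu v hv huv hd
      · intro u hu v hv huv hn hd1 hd2
        rw [Finset.mem_insert] at hu hv
        rcases hu with rfl | hu <;> rcases hv with rfl | hv
        · exact absurd rfl huv
        · simp only [hne v hv, if_false, if_true]
          exact Or.inr (h1 v hv).2
        · simp only [hne u hu, if_false, if_true]
          exact Or.inl (h1 u hu).2
        · simp only [hne u hu, hne v hv, if_false]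
          exact h3 u hu v hv huv hn hd1 hd2

/-- The least shift that makes the two numbers equal is `b + 1`, where `b` is the most significant
bit in which they differ. -/
theorem exists_first_differing_bit {l m d : ℕ} (hlm : l < m) (hm : m < 2 ^ d) :
    ∃ b < d, l / 2 ^ (b + 1) = m / 2 ^ (b + 1) ∧ (l / 2 ^ b) % 2 = 0 ∧ (m / 2 ^ b) % 2 = 1 := by
  have hex : ∃ b, l / 2 ^ b = m / 2 ^ b :=
    ⟨d, by rw [Nat.div_eq_of_lt hm, Nat.div_eq_of_lt (hlm.trans hm)]⟩
  classical
  have hspec := Nat.find_spec hex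
  have hle : Nat.find hex ≤ d :=
    Nat.find_min' hex (by rw [Nat.div_eq_of_lt hm, Nat.div_eq_of_lt (hlm.trans hm)])
  rcases h : Nat.find hex with _ | b
  · rw [h] at hspec
    simp at hspec
    omega
  · rw [h] at hspec
    have hb : ¬ l / 2 ^ b = m / 2 ^ b := Nat.find_min hex (by omega)
    refine ⟨b, by omega, hspec, ?_⟩
    have hmono : l / 2 ^ b ≤ m / 2 ^ b := Nat.div_le_div_right hlm.le
    rw [pow_succ, ← Nat.div_div_eq_div_mul, ← Nat.div_div_eq_div_mul] at hspec
    omega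

open Classical in
/-- The modified right end of an interval `[l, R]` at bit `b`: it is `1` if the interval leaves the
dyadic block of length `2 ^ (b + 1)` that contains `l`. -/
noncomputable def endCoord (N b l R : ℕ) : ℝ :=
  if (l / 2 ^ (b + 1) + 1) * 2 ^ (b + 1) ≤ R then 1 else (R : ℝ) / (2 * N)

open Classical in
/-- The coordinate of an interval `[l, R]` that separates it from those intervals which it misses
and whose left ends first differ from `l` in bit `b`. -/
noncomputable def bitCoord (N b l R : ℕ) : ℝ :=
  if (l / 2 ^ (b + 1)) % 2 = 0 then
    if (l / 2 ^ b) % 2 = 0 then endCoord N b l R else 1 + (l : ℝ) / (2 * N)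
  else
    if (l / 2 ^ b) % 2 = 0 then 2 - endCoord N b l R else 1 - (l : ℝ) / (2 * N)

/-- For intersecting intervals, each left end is at most the other right end, so `1 + l/(2N)`
exceeds the other end coordinate by at most `1`. Odd dyadic blocks use the mirror image about `1`;
two left halves of opposite parity then need their end coordinates to sum to at least `1`, which the
value `1` of `endCoord` ensures. -/
theorem abs_bitCoord_sub_le {N b l R l' R' : ℕ} (h : l ≤ R) (hR : R < N) (h' : l' ≤ R')
    (hR' : R' < N) (h1 : l ≤ R') (h2 : l' ≤ R) :
    |bitCoord N b l R - bitCoord N b l' R'| ≤ 1 := by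
  have hN : (0 : ℝ) < 2 * N := by
    have : 0 < N := by omega
    positivity
  have hmono : ∀ x y : ℕ, x ≤ y → (x : ℝ) / (2 * N) ≤ (y : ℝ) / (2 * N) := fun x y hxy =>
    div_le_div_of_nonneg_right (by exact_mod_cast hxy) hN.le
  have hhalf : ∀ x : ℕ, x < N → (x : ℝ) / (2 * N) ≤ 1 / 2 := by
    intro x hx
    rw [div_le_iff₀ hN]
    have : (x : ℝ) ≤ N := by exact_mod_cast hx.le
    linarith
  have hpos : ∀ x : ℕ, 0 ≤ (x : ℝ) / (2 * N) := fun x => by positivity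
  have e1 : endCoord N b l R = 1 ∨ endCoord N b l R = (R : ℝ) / (2 * N) := by
    unfold endCoord; split_ifs <;> simp
  have e2 : endCoord N b l' R' = 1 ∨ endCoord N b l' R' = (R' : ℝ) / (2 * N) := by
    unfold endCoord; split_ifs <;> simp
  -- The interval that starts in the earlier block contains the other left end, hence leaves its own
  -- block.
  have e3 : (l / 2 ^ (b + 1)) % 2 ≠ (l' / 2 ^ (b + 1)) % 2 →
      endCoord N b l R = 1 ∨ endCoord N b l' R' = 1 := by
    intro hne
    have key : ∀ x y z : ℕ, x / 2 ^ (b + 1) < y / 2 ^ (b + 1) → y ≤ z →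
        endCoord N b x z = 1 := by
      intro x y z hxy hyz
      rw [endCoord, if_pos]
      exact ((Nat.mul_le_mul_right _ hxy).trans (Nat.div_mul_le_self _ _)).trans hyz
    rcases lt_trichotomy (l / 2 ^ (b + 1)) (l' / 2 ^ (b + 1)) with hlt | heq | hlt
    · exact Or.inl (key _ _ _ hlt h2)
    · exact absurd (by rw [heq]) hne
    · exact Or.inr (key _ _ _ hlt h1)
  have a1 := hmono _ _ h
  have a2 := hmono _ _ h'
  have a3 := hmono _ _ h1
  have a4 := hmono _ _ h2
  have a5 := hhalf _ hR
  have a6 := hhalf _ hR'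
  have a7 := hpos l
  have a8 := hpos l'
  rw [abs_le]
  unfold bitCoord
  generalize endCoord N b l R = G at *
  generalize endCoord N b l' R' = G' at *
  generalize (l : ℝ) / (2 * N) = x at *
  generalize (l' : ℝ) / (2 * N) = x' at *
  generalize (R : ℝ) / (2 * N) = y at *
  generalize (R' : ℝ) / (2 * N) = y' at *
  have hG : x ≤ G ∧ x' ≤ G ∧ G ≤ 1 := by
    rcases e1 with rfl | rfl
    · exact ⟨by linarith, by linarith, by linarith⟩
    · exact ⟨by linarith, by linarith, by linarith⟩
  have hG' : x ≤ G' ∧ x' ≤ G' ∧ G' ≤ 1 := by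
    rcases e2 with rfl | rfl
    · exact ⟨by linarith, by linarith, by linarith⟩
    · exact ⟨by linarith, by linarith, by linarith⟩
  have hsum : (l / 2 ^ (b + 1)) % 2 ≠ (l' / 2 ^ (b + 1)) % 2 → 1 ≤ G + G' := by
    intro hne
    rcases e3 hne with rfl | rfl <;> linarith
  split_ifs
  all_goals first
    | (constructor <;> linarith)
    | (have := hsum (by omega); constructor <;> linarith)

/-- Both left ends lie in one block and the first interval stops before `l'`, so its end coordinate
is the true `R/(2N)`. The gap is `1 + (l' - R)/(2N)`. -/
theorem one_lt_bitCoord_sub {N b l R l' R' : ℕ} (hN : 0 < N) (hlt : R < l')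
    (h0 : l / 2 ^ (b + 1) = l' / 2 ^ (b + 1)) (h1 : (l / 2 ^ b) % 2 = 0)
    (h2 : (l' / 2 ^ b) % 2 = 1) : 1 < |bitCoord N b l R - bitCoord N b l' R'| := by
  have hend : endCoord N b l R = (R : ℝ) / (2 * N) := by
    rw [endCoord, if_neg]
    rw [h0, not_le, add_mul, one_mul]
    have := Nat.div_add_mod l' (2 ^ (b + 1))
    have := Nat.mod_lt l' (y := 2 ^ (b + 1)) (by positivity)
    rw [mul_comm]
    omega
  have hN' : (0 : ℝ) < 2 * N := by positivity
  have hmono : (R : ℝ) / (2 * N) < (l' : ℝ) / (2 * N) :=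
    div_lt_div_of_pos_right (by exact_mod_cast hlt) hN'
  have h2' : ¬ (l' / 2 ^ b) % 2 = 0 := by omega
  unfold bitCoord
  rw [h0, hend]
  simp only [h1, h2', if_true, if_false]
  split_ifs
  · rw [abs_sub_comm, lt_abs]
    left
    linarith
  · rw [lt_abs]
    left
    linarith

/-- A finite graded forest on at most `2 ^ d` vertices has a cube representation in dimension
`d + 1`: one coordinate is the grade and the others read off the bits of a preorder numbering. -/
theorem exists_isCubeRep_of_graded {V : Type u} [Fintype V] (G : SimpleGraph V) (δ : V → ℕ)
    (hadj : ∀ u v, G.Adj u v → δ v = δ u + 1 ∨ δ u = δ v + 1)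
    (huniq : ∀ u u' v, G.Adj u v → G.Adj u' v → δ v = δ u + 1 → δ v = δ u' + 1 → u = u')
    {d : ℕ} (hd : Fintype.card V ≤ 2 ^ d) :
    ∃ f : V → Fin (d + 1) → ℝ, IsCubeRep G f := by
  obtain ⟨l, R, h1, h2, h3⟩ := exists_interval_numbering G δ hadj huniq Finset.univ
  simp only [Finset.mem_univ, true_implies, Finset.card_univ] at h1 h2 h3
  have hint : ∀ u v, G.Adj u v → l u ≤ R v ∧ l v ≤ R u := by
    intro u v huv
    rcases hadj u v huv with h | h
    · have := h2 u v huv h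
      have := h1 v
      omega
    · have := h2 v u huv.symm h
      have := h1 u
      omega
  refine ⟨fun v => Fin.cons (δ v : ℝ) fun b : Fin d => bitCoord (2 ^ d) b (l v) (R v), ?_⟩
  rw [isCubeRep_iff]
  intro u v huv
  rw [pi_norm_le_iff_of_nonneg zero_le_one]
  constructor
  · intro h k
    rw [Pi.sub_apply, Real.norm_eq_abs]
    refine Fin.cases ?_ (fun b => ?_) k
    · rw [Fin.cons_zero, Fin.cons_zero, abs_le]
      rcases hadj u v h with h | h <;> rw [h] <;> push_cast <;> constructor <;> linarith
    · rw [Fin.cons_succ, Fin.cons_succ]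
      exact abs_bitCoord_sub_le (h1 u).1 ((h1 u).2.trans_le hd) (h1 v).1 ((h1 v).2.trans_le hd)
        (hint u v h).1 (hint u v h).2
  · intro h
    -- The grade coordinate forces the grades to differ by at most one, so the intervals are
    -- disjoint and the leading bit in which their left ends differ separates them.
    by_contra hn
    have hδ := h 0
    rw [Pi.sub_apply, Real.norm_eq_abs, Fin.cons_zero, Fin.cons_zero, abs_le] at hδ
    have hd1 : δ u ≤ δ v + 1 := by
      have : (δ u : ℝ) ≤ δ v + 1 := by linarith
      exact_mod_cast this
    have hd2 : δ v ≤ δ u + 1 := by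
      have : (δ v : ℝ) ≤ δ u + 1 := by linarith
      exact_mod_cast this
    have hsep : ∀ x y, R x < l y → ∃ b : Fin d,
        1 < |bitCoord (2 ^ d) b (l x) (R x) - bitCoord (2 ^ d) b (l y) (R y)| := by
      intro x y hxy
      have hx := h1 x
      have hy := h1 y
      obtain ⟨b, hb, hb1, hb2, hb3⟩ :=
        exists_first_differing_bit (l := l x) (m := l y) (d := d) (by omega) (by omega)
      exact ⟨⟨b, hb⟩, one_lt_bitCoord_sub (by positivity) hxy hb1 hb2 hb3⟩
    rcases h3 u v huv hn hd1 hd2 with h4 | h4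
    · obtain ⟨b, hb⟩ := hsep u v h4
      have := h b.succ
      rw [Pi.sub_apply, Real.norm_eq_abs, Fin.cons_succ, Fin.cons_succ] at this
      linarith
    · obtain ⟨b, hb⟩ := hsep v u h4
      have := h b.succ
      rw [Pi.sub_apply, Real.norm_eq_abs, Fin.cons_succ, Fin.cons_succ, abs_sub_comm] at this
      linarith

end GradedForest

/-! ### Anti-concentration of sums of random signs -/

section AntiConcentration

theorem centralBinom_sq_le (n : ℕ) : (3 * n + 1) * n.centralBinom ^ 2 ≤ 16 ^ n := by
  induction n with
  | zero => simp
  | succ n ih =>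
    have h := Nat.succ_mul_centralBinom_succ n
    have h2 : (n + 1) ^ 2 * ((3 * (n + 1) + 1) * (n + 1).centralBinom ^ 2) ≤
        (n + 1) ^ 2 * 16 ^ (n + 1) := by
      calc (n + 1) ^ 2 * ((3 * (n + 1) + 1) * (n + 1).centralBinom ^ 2)
          = (3 * n + 4) * ((n + 1) * (n + 1).centralBinom) ^ 2 := by ring
        _ = 4 * ((3 * n + 4) * (2 * n + 1) ^ 2) * n.centralBinom ^ 2 := by rw [h]; ring
        -- The two cubic polynomials in `n` differ by exactly `n`; this is why the factor `3n + 1`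
        -- is propagated.
        _ ≤ 4 * ((3 * n + 1) * (2 * n + 2) ^ 2) * n.centralBinom ^ 2 := by
          gcongr 4 * ?_ * _
          nlinarith
        _ = 16 * (n + 1) ^ 2 * ((3 * n + 1) * n.centralBinom ^ 2) := by ring
        _ ≤ 16 * (n + 1) ^ 2 * 16 ^ n := by gcongr
        _ = (n + 1) ^ 2 * 16 ^ (n + 1) := by ring
    exact Nat.le_of_mul_le_mul_left h2 (by positivity)

theorem choose_half_sq_le (m : ℕ) : 3 * m * (m.choose (m / 2)) ^ 2 ≤ 2 * 4 ^ m := by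
  rcases Nat.even_or_odd' m with ⟨n, rfl | rfl⟩
  · have h := centralBinom_sq_le n
    rw [Nat.centralBinom] at h
    rw [Nat.mul_div_cancel_left _ (by norm_num), pow_mul]
    norm_num
    nlinarith
  · have h := centralBinom_sq_le (n + 1)
    -- The middle coefficient of an odd row is half the central coefficient of the next row.
    have h2 : (n + 1).centralBinom = 2 * (2 * n + 1).choose n := by
      rw [Nat.centralBinom, mul_add, mul_one, Nat.choose_succ_succ, Nat.choose_symm_half]
      ring
    rw [h2] at h
    have h3 : (2 * n + 1) / 2 = n := by omega
    have h4 : 4 ^ (2 * n + 1) = 4 * 16 ^ n := by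
      rw [pow_succ, pow_mul]; norm_num; ring
    have h5 : 16 ^ (n + 1) = 16 * 16 ^ n := by ring
    rw [h3, h4]
    rw [h5] at h
    nlinarith [sq_nonneg ((2 * n + 1).choose n)]

/-- The probability that a sum of `m` random signs lies in a given closed interval of length `2` is
at most twice the largest point probability. -/
noncomputable def signProb (m : ℕ) : ℝ := 2 * (m.choose (m / 2)) / 2 ^ m

theorem signProb_nonneg (m : ℕ) : 0 ≤ signProb m := by unfold signProb; positivity

theorem signProb_sq_le {m : ℕ} (hm : 0 < m) : signProb m ^ 2 ≤ 8 / (3 * m) := by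
  have h : (3 * m * (m.choose (m / 2)) ^ 2 : ℝ) ≤ 2 * 4 ^ m := by
    exact_mod_cast choose_half_sq_le m
  have hm' : (0 : ℝ) < 3 * m := by positivity
  have h4 : ((2 : ℝ) ^ m) ^ 2 = 4 ^ m := by rw [← pow_mul, mul_comm, pow_mul]; norm_num
  rw [signProb, div_pow, h4, div_le_div_iff₀ (by positivity) hm']
  nlinarith

variable {E : Type*} [Fintype E] [DecidableEq E]

theorem card_filter_card_inter_eq_le (M : Finset E) (a : ℕ) :
    (Finset.univ.filter fun A : Finset E => (A ∩ M).card = a).card ≤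
      M.card.choose a * 2 ^ (Mᶜ).card := by
  rw [← Finset.card_powersetCard, ← Finset.card_powerset, ← Finset.card_product]
  refine Finset.card_le_card_of_injOn (fun A => (A ∩ M, A \ M)) ?_ ?_
  · intro A hA
    have hA' : (A ∩ M).card = a := by simpa using hA
    simp only [Finset.coe_product, Set.mem_prod, Finset.mem_coe, Finset.mem_powersetCard,
      Finset.mem_powerset]
    exact ⟨⟨Finset.inter_subset_right, hA'⟩, fun x hx => by
      simpa using (Finset.mem_sdiff.1 hx).2⟩
  · intro A _ B _ h
    rw [Prod.mk.injEq] at h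
    rw [← Finset.sdiff_union_inter A M, ← Finset.sdiff_union_inter B M, h.1, h.2]

/-- The set of the edges of `M` whose signed bit is `1`, together with the true bits outside `M`. -/
noncomputable def plusSet (M : Finset E) (ε : E → ℝ) (ω : E → Bool) : Finset E :=
  open Classical in Finset.univ.filter fun e => (ω e = true ↔ ¬ (e ∈ M ∧ ε e = -1))

theorem plusSet_injective (M : Finset E) (ε : E → ℝ) : Function.Injective (plusSet M ε) := by
  classical
  intro ω ω' h
  funext e
  have : e ∈ plusSet M ε ω ↔ e ∈ plusSet M ε ω' := by rw [h]
  simp only [plusSet, Finset.mem_filter, Finset.mem_univ, true_and] at this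
  rw [Bool.eq_iff_iff]
  tauto

theorem sum_bitSign_eq (M : Finset E) (ε : E → ℝ) (hε : ∀ e ∈ M, ε e = 1 ∨ ε e = -1)
    (ω : E → Bool) :
    ∑ e ∈ M, ε e * (bitSign (ω e) : ℝ) = 2 * ((plusSet M ε ω ∩ M).card : ℝ) - M.card := by
  classical
  have h1 : ∀ e ∈ M, ε e * (bitSign (ω e) : ℝ) =
      2 * (if e ∈ plusSet M ε ω then 1 else 0) - 1 := by
    intro e he
    simp only [plusSet, Finset.mem_filter, Finset.mem_univ, true_and, he]
    rcases hε e he with h | h <;> cases hω : ω e <;> simp [bitSign, h] <;> norm_num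
  rw [Finset.sum_congr rfl h1, Finset.sum_sub_distrib, ← Finset.mul_sum, Finset.sum_boole,
    Finset.filter_mem_eq_inter, Finset.inter_comm]
  simp

/-- The sum is `2a - |M|`, where `a` counts the signed bits equal to `1`, so an interval of length
`2` allows at most two consecutive values of `a`. Each has at most a middle binomial coefficient of
choices on `M`. -/
theorem card_sign_sum_le (M : Finset E) (ε : E → ℝ) (hε : ∀ e ∈ M, ε e = 1 ∨ ε e = -1) (x : ℝ) :
    ((Finset.univ.filter fun ω : E → Bool =>
      |x + ∑ e ∈ M, ε e * (bitSign (ω e) : ℝ)| ≤ 1).card : ℝ) ≤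
      signProb M.card * 2 ^ Fintype.card E := by
  classical
  set B := Finset.univ.filter fun ω : E → Bool =>
    |x + ∑ e ∈ M, ε e * (bitSign (ω e) : ℝ)| ≤ 1 with hB
  rcases B.eq_empty_or_nonempty with h0 | h0
  · rw [h0, Finset.card_empty, Nat.cast_zero]
    exact mul_nonneg (signProb_nonneg _) (by positivity)
  obtain ⟨ω₀, hω₀, hmin⟩ := B.exists_min_image (fun ω => (plusSet M ε ω ∩ M).card) h0
  set a := (plusSet M ε ω₀ ∩ M).card
  have hsub : B.image (plusSet M ε) ⊆
      (Finset.univ.filter fun A : Finset E => (A ∩ M).card = a) ∪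
      (Finset.univ.filter fun A : Finset E => (A ∩ M).card = a + 1) := by
    intro A hA
    obtain ⟨ω, hω, rfl⟩ := Finset.mem_image.1 hA
    have h1 := hmin ω hω
    simp only [hB, Finset.mem_filter, Finset.mem_univ, true_and] at hω hω₀
    rw [sum_bitSign_eq M ε hε, abs_le] at hω hω₀
    have h2 : ((plusSet M ε ω ∩ M).card : ℝ) ≤ a + 1 := by linarith [hω.2, hω₀.1]
    have h3 : (plusSet M ε ω ∩ M).card ≤ a + 1 := by exact_mod_cast h2
    simp only [Finset.mem_union, Finset.mem_filter, Finset.mem_univ, true_and]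
    omega
  have hcard : B.card ≤ 2 * M.card.choose (M.card / 2) * 2 ^ (Mᶜ).card := by
    rw [← Finset.card_image_of_injective B (plusSet_injective M ε)]
    calc _ ≤ _ := Finset.card_le_card hsub
      _ ≤ _ := Finset.card_union_le _ _
      _ ≤ M.card.choose a * 2 ^ (Mᶜ).card + M.card.choose (a + 1) * 2 ^ (Mᶜ).card :=
        add_le_add (card_filter_card_inter_eq_le M a) (card_filter_card_inter_eq_le M (a + 1))
      _ ≤ M.card.choose (M.card / 2) * 2 ^ (Mᶜ).card +
          M.card.choose (M.card / 2) * 2 ^ (Mᶜ).card := by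
        gcongr <;> exact Nat.choose_le_middle _ _
      _ = _ := by ring
  have hE : (2 : ℝ) ^ Fintype.card E = 2 ^ M.card * 2 ^ (Mᶜ).card := by
    rw [← pow_add, Finset.card_add_card_compl]
  rw [hE, signProb]
  have : (2 * (M.card.choose (M.card / 2)) / 2 ^ M.card * (2 ^ M.card * 2 ^ (Mᶜ).card) : ℝ) =
      2 * M.card.choose (M.card / 2) * 2 ^ (Mᶜ).card := by field_simp
  rw [this]
  exact_mod_cast hcard

/-- The bits of different coordinates are independent: the event is a product over `k` of the
one-coordinate events. -/
theorem card_forall_sign_sum_le {t : ℕ} (M : Finset E) (ε : E → ℝ)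
    (hε : ∀ e ∈ M, ε e = 1 ∨ ε e = -1) (x : (E → Fin t → Bool) → Fin t → ℝ)
    (hx : ∀ ω ω' k, x ω k = x ω' k) :
    ((Finset.univ.filter fun ω : E → Fin t → Bool =>
      ∀ k, |x ω k + ∑ e ∈ M, ε e * (bitSign (ω e k) : ℝ)| ≤ 1).card : ℝ) ≤
      signProb M.card ^ t * Fintype.card (E → Fin t → Bool) := by
  classical
  let ω₀ : E → Fin t → Bool := fun _ _ => true
  let B : Fin t → Finset (E → Bool) := fun k => Finset.univ.filter fun η : E → Bool =>
    |x ω₀ k + ∑ e ∈ M, ε e * (bitSign (η e) : ℝ)| ≤ 1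
  have h1 : (Finset.univ.filter fun ω : E → Fin t → Bool =>
      ∀ k, |x ω k + ∑ e ∈ M, ε e * (bitSign (ω e k) : ℝ)| ≤ 1).card ≤
      (Fintype.piFinset B).card := by
    refine Finset.card_le_card_of_injOn (fun ω k e => ω e k) ?_ ?_
    · intro ω hω
      have hω' := (Finset.mem_filter.1 hω).2
      rw [Finset.mem_coe, Fintype.mem_piFinset]
      intro k
      rw [Finset.mem_filter, hx ω₀ ω k]
      exact ⟨Finset.mem_univ _, hω' k⟩
    · intro ω _ ω' _ h
      funext e k
      exact congrFun (congrFun h k) e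
  have h2 : ((Fintype.piFinset B).card : ℝ) ≤ (signProb M.card * 2 ^ Fintype.card E) ^ t := by
    rw [Fintype.card_piFinset, Nat.cast_prod]
    calc ∏ k, ((B k).card : ℝ) ≤ ∏ _k : Fin t, (signProb M.card * 2 ^ Fintype.card E) :=
          Finset.prod_le_prod (fun _ _ => by positivity) fun k _ =>
            card_sign_sum_le M ε hε (x ω₀ k)
      _ = _ := by simp
  have h3 : (Fintype.card (E → Fin t → Bool) : ℝ) = (2 ^ Fintype.card E) ^ t := by
    rw [Fintype.card_fun, Fintype.card_fun, Fintype.card_bool, Fintype.card_fin]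
    push_cast
    rw [← pow_mul, ← pow_mul, mul_comm]
  rw [h3, ← mul_pow]
  exact (Nat.cast_le.2 h1).trans h2

end AntiConcentration

/-! ### Scales and deleted edges -/

section Cuts

/-- A residue class modulo `3h` meets every interval of length `L` at least `L/(3h) - 1` times. -/
theorem card_cutDepth (X : Side) {h : ℕ} (hh : 0 < h) (a b : ℕ) [DecidablePred (IsCutDepth X h)] :
    b ≤ a + 3 * h * (((Finset.Ico a b).filter (IsCutDepth X h)).card + 1) := by
  classical
  have hr : 0 < 3 * h := by omega
  have hrq : (0 : ℚ) < ((3 * h : ℕ) : ℚ) := by exact_mod_cast hr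
  have key : ∀ v : ℕ, b ≤ a + 3 * h * (((Finset.Ico a b).filter (· ≡ v [MOD 3 * h])).card + 1) := by
    intro v
    have h1 := Nat.Ico_filter_modEq_card a b hr v
    set c := ((Finset.Ico a b).filter (· ≡ v [MOD 3 * h])).card
    have h2 := (le_max_left _ _).trans h1.ge
    have h3 : ((b : ℚ) - v) / ((3 * h : ℕ) : ℚ) - (((a : ℚ) - v) / ((3 * h : ℕ) : ℚ) + 1) ≤ c := by
      have h4 := Int.le_ceil (((b : ℚ) - v) / ((3 * h : ℕ) : ℚ))
      have h5 := (Int.ceil_lt_add_one (((a : ℚ) - v) / ((3 * h : ℕ) : ℚ))).le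
      have h6 : ((⌈((b : ℚ) - v) / ((3 * h : ℕ) : ℚ)⌉ -
        ⌈((a : ℚ) - v) / ((3 * h : ℕ) : ℚ)⌉ : ℤ) : ℚ) ≤ ((c : ℤ) : ℚ) := Int.cast_le.2 h2
      push_cast at h4 h5 h6 ⊢
      linarith
    rw [div_add_one hrq.ne', ← sub_div, div_le_iff₀ hrq] at h3
    have h4 : (b : ℚ) ≤ a + ((3 * h : ℕ) : ℚ) * (c + 1) := by linarith
    exact_mod_cast h4
  cases X with
  | B =>
    convert key h using 5
    ext j
    simp [IsCutDepth]
  | A =>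
    -- For kind `A`, depth `0` is a multiple of `3h` but not a cut. Counting multiples from `0`
    -- loses nothing to rounding, which compensates for it.
    rcases Nat.eq_zero_or_pos a with rfl | ha
    · have h1 := Nat.Ico_filter_modEq_card 0 b hr 0
      set c := ((Finset.Ico 0 b).filter (· ≡ 0 [MOD 3 * h])).card
      have h2 := (le_max_left _ _).trans h1.ge
      have h3 : ((b : ℚ)) / ((3 * h : ℕ) : ℚ) ≤ c := by
        have h4 := Int.le_ceil (((b : ℚ)) / ((3 * h : ℕ) : ℚ))
        simp only [Nat.cast_zero, sub_zero, zero_div, Int.ceil_zero] at h2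
        have h6 : ((⌈(b : ℚ) / ((3 * h : ℕ) : ℚ)⌉ : ℤ) : ℚ) ≤ ((c : ℤ) : ℚ) := Int.cast_le.2 h2
        push_cast at h4 h6 ⊢
        linarith
      rw [div_le_iff₀ hrq] at h3
      have h4 : b ≤ c * (3 * h) := by exact_mod_cast h3
      have h5 : c ≤ ((Finset.Ico 0 b).filter (IsCutDepth Side.A h)).card + 1 := by
        refine (Finset.card_le_card (t := insert 0 ((Finset.Ico 0 b).filter
          (IsCutDepth Side.A h))) ?_).trans (Finset.card_insert_le _ _)
        intro j hj
        rw [Finset.mem_filter] at hj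
        rw [Finset.mem_insert, Finset.mem_filter]
        rcases Nat.eq_zero_or_pos j with h0 | h0
        · exact Or.inl h0
        · exact Or.inr ⟨hj.1, h0, (Nat.modEq_zero_iff_dvd).1 hj.2⟩
      nlinarith
    · convert key 0 using 6 with j hj
      rw [Nat.modEq_zero_iff_dvd]
      have := (Finset.mem_Ico.1 hj).1
      simp only [IsCutDepth]
      exact ⟨fun h => h.2, fun h => ⟨by omega, h⟩⟩

theorem cutDepth_gap {h i j : ℕ} (hi : IsCutDepth Side.A h i) (hj : IsCutDepth Side.B h j) :
    i + h ≤ j ∨ j + h ≤ i := by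
  obtain ⟨-, c, rfl⟩ := hi
  have hj' : (j : ℤ) ≡ h [ZMOD ((3 * h : ℕ) : ℤ)] := Int.natCast_modEq_iff.2 hj
  obtain ⟨d, hd⟩ := hj'.symm.dvd
  push_cast at hd
  have h0 : (0 : ℤ) ≤ h := by positivity
  rcases le_or_gt (c : ℤ) d with hcd | hcd
  · left
    have : (c * h : ℤ) ≤ d * h := mul_le_mul_of_nonneg_right hcd h0
    zify
    linarith
  · right
    have : ((d + 1) * h : ℤ) ≤ c * h := mul_le_mul_of_nonneg_right hcd h0
    zify
    linarith

/-- This nests the cut sets, `O_i` inside `O_{i+2}`. For kind `B` it rests on `q^4 ≡ q` modulo `3q`,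
true because `q ≡ 1` modulo `3`. -/
theorem IsCutDepth.of_pow_four {X : Side} {q j : ℕ} (hq : q % 3 = 1)
    (hj : IsCutDepth X (q ^ 4) j) : IsCutDepth X q j := by
  have hdvd : 3 * q ∣ 3 * q ^ 4 := ⟨q ^ 3, by ring⟩
  cases X with
  | A => exact ⟨hj.1, hdvd.trans hj.2⟩
  | B =>
    refine (Nat.ModEq.of_dvd hdvd hj).trans ?_
    have h3 : q ^ 3 ≡ 1 [MOD 3] := by
      have : q ≡ 1 [MOD 3] := hq
      simpa using this.pow 3
    have := h3.mul_right' q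
    rw [one_mul] at this
    rwa [← pow_succ] at this

theorem dist_le_length_of_mem_support {V : Type u} {G : SimpleGraph V} {u v x y : V}
    (p : G.Walk u v) (hx : x ∈ p.support) (hy : y ∈ p.support) : G.dist x y ≤ p.length := by
  classical
  have key : ∀ {u v x y : V} (p : G.Walk u v) (hx : x ∈ p.support),
      y ∈ (p.dropUntil x hx).support → G.dist x y ≤ p.length := by
    intro u v x y p hx hy
    exact (SimpleGraph.dist_le ((p.dropUntil x hx).takeUntil y hy)).trans
      ((SimpleGraph.Walk.length_takeUntil_le_length _ hy).trans
        (SimpleGraph.Walk.length_dropUntil_le_length _ hx))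
  have hy' := hy
  rw [← p.take_spec hx, SimpleGraph.Walk.mem_support_append_iff] at hy'
  rcases hy' with h | h
  · have h2 := (SimpleGraph.dist_le ((p.takeUntil x hx).dropUntil y h)).trans
      ((SimpleGraph.Walk.length_dropUntil_le_length _ h).trans
        (SimpleGraph.Walk.length_takeUntil_le_length _ hx))
    rwa [SimpleGraph.dist_comm] at h2
  · exact key p hx h

variable {V : Type u} [Fintype V] {T : SimpleGraph V} {r : V}

theorem scale_pos (T : SimpleGraph V) (r : V) (i : ℕ) : 0 < scale T r i := by
  unfold scale; positivity

theorem scale_anti (T : SimpleGraph V) (r : V) {i j : ℕ} (h : i ≤ j) :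
    scale T r j ≤ scale T r i := by
  unfold scale
  gcongr <;> norm_num

theorem exists_scale_eq {i : ℕ} (h : 2 ^ 16 < scale T r i) :
    ∃ q, 256 ≤ q ∧ q % 3 = 1 ∧ scale T r (i + 2) = q ∧ scale T r (i + 1) = q ^ 2 ∧
      scale T r i = q ^ 4 := by
  have h5 : 5 ≤ kExp T r - i := by
    by_contra hlt
    have h1 : 2 ^ (kExp T r - i) ≤ 2 ^ 4 := Nat.pow_le_pow_right (by norm_num) (by omega)
    have h2 : 2 ^ 2 ^ (kExp T r - i) ≤ 2 ^ 2 ^ 4 := Nat.pow_le_pow_right (by norm_num) h1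
    unfold scale at h
    norm_num at h h2
    omega
  obtain ⟨s, hs⟩ : ∃ s, kExp T r - i = s + 5 := ⟨kExp T r - i - 5, by omega⟩
  refine ⟨2 ^ 2 ^ (s + 3), ?_, ?_, ?_, ?_, ?_⟩
  · have h1 : 2 ^ 3 ≤ 2 ^ (s + 3) := Nat.pow_le_pow_right (by norm_num) (by omega)
    calc 256 = 2 ^ 2 ^ 3 := by norm_num
      _ ≤ 2 ^ 2 ^ (s + 3) := Nat.pow_le_pow_right (by norm_num) h1
  -- `q` is a power of `4`, hence `1` modulo `3`.
  · rw [pow_succ 2 (s + 2), mul_comm, pow_mul, Nat.pow_mod]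
    norm_num
  · rw [scale, show kExp T r - (i + 2) = s + 3 by omega]
  · rw [scale, show kExp T r - (i + 1) = s + 4 by omega, ← pow_mul]
    congr 1
  · rw [scale, hs, ← pow_mul]
    congr 1
    ring

theorem exists_idx (T : SimpleGraph V) (r : V) :
    ∃ m, scale T r m ≤ 2 ^ 16 ∧ (∀ i < m, 2 ^ 16 < scale T r i) ∧
      (evenIdx T r = m ∧ oddIdx T r = m + 1 ∨ oddIdx T r = m ∧ evenIdx T r = m + 1) := by
  classical
  have hex : ∃ m, scale T r m ≤ 2 ^ 16 := ⟨kExp T r, by unfold scale; norm_num⟩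
  set m := Nat.find hex
  have hm : scale T r m ≤ 2 ^ 16 := Nat.find_spec hex
  have hmin : ∀ i < m, 2 ^ 16 < scale T r i := fun i hi => not_le.1 (Nat.find_min hex hi)
  have hm1 : scale T r (m + 1) ≤ 2 ^ 16 := (scale_anti T r (Nat.le_succ m)).trans hm
  have hkey : ∀ (P : ℕ → Prop) (n : ℕ), P n → scale T r n ≤ 2 ^ 16 → (∀ i, P i → m ≤ i → n ≤ i) →
      sInf {i : ℕ | P i ∧ scale T r i ≤ 2 ^ 16} = n := by
    intro P n hn hs hle
    refine le_antisymm (Nat.sInf_le ⟨hn, hs⟩) (le_csInf ⟨n, hn, hs⟩ ?_)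
    rintro i ⟨hi, hsi⟩
    refine hle i hi (not_lt.1 fun hlt => ?_)
    have := hmin i hlt
    omega
  refine ⟨m, hm, hmin, ?_⟩
  rcases Nat.even_or_odd m with he | ho
  · left
    refine ⟨hkey _ _ he hm fun i _ h => h, hkey _ _ he.add_one hm1 fun i hi h => ?_⟩
    rcases h.eq_or_lt with rfl | h
    · exact absurd he (Nat.not_even_iff_odd.2 hi)
    · exact h
  · right
    refine ⟨hkey _ _ ho hm fun i _ h => h, hkey _ _ ho.add_one hm1 fun i hi h => ?_⟩
    rcases h.eq_or_lt with rfl | h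
    · exact absurd hi (Nat.not_even_iff_odd.2 ho)
    · exact h

theorem scale_gt_of_add_two_le {i : ℕ} (h : i + 2 ≤ max (evenIdx T r) (oddIdx T r)) :
    2 ^ 16 < scale T r i := by
  obtain ⟨m, -, h1, h2⟩ := exists_idx T r
  apply h1
  rcases h2 with ⟨h2, h3⟩ | ⟨h2, h3⟩ <;> rw [h2, h3] at h <;> simp at h <;> omega

theorem forest_le (T : SimpleGraph V) (r : V) (X : Side) (i : ℕ) : forest T r X i ≤ T :=
  SimpleGraph.deleteEdges_le _

theorem forest_adj_iff (X : Side) (i : ℕ) {u v : V} (hd : depth T r v = depth T r u + 1) :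
    (forest T r X i).Adj u v ↔ T.Adj u v ∧ ¬ IsCutDepth X (scale T r i) (depth T r u) := by
  rw [forest, SimpleGraph.deleteEdges_adj]
  refine and_congr_right fun h => not_congr ⟨?_, fun hc => ⟨u, v, h, rfl, hd, hc⟩⟩
  rintro ⟨u', v', -, he, hd', hc⟩
  rcases Sym2.eq_iff.1 he with ⟨rfl, rfl⟩ | ⟨rfl, rfl⟩
  · exact hc
  · omega

theorem ancEdge_mem_forest_iff (hT : T.IsTree) (X : Side) (i : ℕ) {u : V} {j : ℕ}
    (hj : j < depth T r u) :
    ancEdge T r u (j + 1) ∈ (forest T r X i).edgeSet ↔ ¬ IsCutDepth X (scale T r i) j := by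
  have h1 := depth_anc (r := r) hT (v := u) (j := j) hj.le
  have h2 := depth_anc (r := r) hT (v := u) (j := j + 1) hj
  rw [ancEdge, par_anc hj, SimpleGraph.mem_edgeSet, forest_adj_iff X i (by omega), h1]
  exact and_iff_right (anc_adj hT hj)

theorem forest_mono (hT : T.IsTree) (X : Side) {i : ℕ} (h : 2 ^ 16 < scale T r i) :
    forest T r X (i + 2) ≤ forest T r X i := by
  obtain ⟨q, -, hq3, h2, -, h0⟩ := exists_scale_eq h
  have key : ∀ u v, depth T r v = depth T r u + 1 → (forest T r X (i + 2)).Adj u v →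
      (forest T r X i).Adj u v := by
    intro u v hd hadj
    rw [forest_adj_iff X _ hd] at hadj ⊢
    refine ⟨hadj.1, fun hc => hadj.2 ?_⟩
    rw [h0] at hc
    rw [h2]
    exact hc.of_pow_four hq3
  intro u v hadj
  rcases depth_adj hT r (forest_le T r X _ hadj) with hd | hd
  · exact key u v hd hadj
  · exact (key v u hd hadj.symm).symm

theorem exists_forest_reachable (hT : T.IsTree) (r : V) (i : ℕ) {u v : V}
    (h : T.dist u v ≤ scale T r i) : ∃ X, (forest T r X i).Reachable u v := by
  obtain ⟨p, hp⟩ := hT.connected.exists_walk_length_eq_dist u v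
  have key : ∀ X, (∃ X, (forest T r X i).Reachable u v) ∨ ∃ x ∈ p.support, ∃ y ∈ p.support,
      depth T r y = depth T r x + 1 ∧ IsCutDepth X (scale T r i) (depth T r x) := by
    intro X
    by_cases hall : ∀ e ∈ p.edges, e ∈ (forest T r X i).edgeSet
    · exact Or.inl ⟨X, ⟨p.transfer _ hall⟩⟩
    · right
      push Not at hall
      obtain ⟨e, he, hn⟩ := hall
      have heT := p.edges_subset_edgeSet he
      have he2 : e ∈ cutEdges T r X i := by
        by_contra hc
        exact hn (by rw [forest, SimpleGraph.edgeSet_deleteEdges]; exact ⟨heT, hc⟩)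
      obtain ⟨x, y, -, rfl, hd, hc⟩ := he2
      exact ⟨x, p.fst_mem_support_of_mem_edges he, y, p.snd_mem_support_of_mem_edges he, hd, hc⟩
  rcases key Side.A with hA | ⟨x, hx, y, hy, hxy, hcA⟩
  · exact hA
  rcases key Side.B with hB | ⟨x', hx', y', hy', hxy', hcB⟩
  · exact hB
  exfalso
  -- Compare the upper end of the shallower cut edge with the lower end of the deeper one: their
  -- depths differ by at least `h_i + 1`, more than the length of the path.
  rcases cutDepth_gap hcA hcB with hg | hg
  · have h1 := dist_le_length_of_mem_support p hx hy'
    have h2 := depth_le_add_dist hT (r := r) x y'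
    omega
  · have h1 := dist_le_length_of_mem_support p hx' hy
    have h2 := depth_le_add_dist hT (r := r) x' y
    omega

/-- A path down from the top inside a component meets no cut depth, so it is no longer than a period
of the cuts. -/
theorem IsTop.depth_le (hT : T.IsTree) {X : Side} {i : ℕ} {F : (forest T r X i).ConnectedComponent}
    {c u : V} (hc : IsTop T r F c) (hu : u ∈ F.supp) :
    depth T r u ≤ depth T r c + 3 * scale T r i := by
  classical
  have h := card_cutDepth X (scale_pos T r i) (depth T r c) (depth T r u)
  have h0 : (Finset.Ico (depth T r c) (depth T r u)).filter
      (IsCutDepth X (scale T r i)) = ∅ := by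
    rw [Finset.filter_eq_empty_iff]
    intro j hj
    rw [Finset.mem_Ico] at hj
    rw [← ancEdge_mem_forest_iff hT X i hj.2]
    exact hc.ancEdge_mem hT (forest_le T r X i) hu (by omega) (by omega)
  rw [h0] at h
  simpa using h

theorem IsTop.dist_le (hT : T.IsTree) {X : Side} {i : ℕ} {F : (forest T r X i).ConnectedComponent}
    {c u : V} (hc : IsTop T r F c) (hu : u ∈ F.supp) : T.dist c u ≤ 3 * scale T r i := by
  have h1 := hc.depth_le hT hu
  have h2 := hc.anc_eq hT (forest_le T r X i) hu
  have h3 := dist_anc_le hT (r := r) h2.1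
  rw [h2.2] at h3
  omega

end Cuts

/-! ### Balls -/

section Balls

variable {V : Type u} [Fintype V] {T : SimpleGraph V}

theorem ediam_ne_top (hT : T.IsTree) : T.ediam ≠ ⊤ :=
  have := hT.connected.nonempty
  SimpleGraph.connected_iff_ediam_ne_top.1 hT.connected

theorem le_rho (T : SimpleGraph V) (v : V) {s : ℕ} (hs : 1 ≤ s) (hsd : s ≤ T.diam) :
    Real.logb 2 (({w : V | T.dist v w ≤ s}.ncard : ℝ) / 2) / Real.logb 2 (2 * (s : ℝ) + 1) ≤
      rho T := by
  refine le_csSup (Set.Finite.bddAbove ?_) ⟨v, s, hs, hsd, rfl⟩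
  refine ((Set.finite_univ (α := V)).prod (Set.finite_Icc 1 T.diam)).image
    (fun p : V × ℕ => Real.logb 2 (({w : V | T.dist p.1 w ≤ p.2}.ncard : ℝ) / 2) /
      Real.logb 2 (2 * (p.2 : ℝ) + 1)) |>.subset ?_
  rintro x ⟨v, s, h1, h2, rfl⟩
  exact ⟨(v, s), ⟨Set.mem_univ _, h1, h2⟩, rfl⟩

variable [Nontrivial V]

theorem one_le_diam (hT : T.IsTree) : 1 ≤ T.diam :=
  Nat.one_le_iff_ne_zero.2 (SimpleGraph.diam_ne_zero_of_ediam_ne_top (ediam_ne_top hT))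

theorem rho_nonneg (hT : T.IsTree) : 0 ≤ rho T := by
  obtain ⟨v⟩ := hT.connected.nonempty
  refine le_trans (div_nonneg (Real.logb_nonneg (by norm_num) ?_)
    (Real.logb_nonneg (by norm_num) ?_)) (le_rho T v le_rfl (one_le_diam hT))
  · obtain ⟨w, hw⟩ := hT.connected.preconnected.exists_adj_of_nontrivial v
    have h2 : ({v, w} : Set V).ncard ≤ {w : V | T.dist v w ≤ 1}.ncard := by
      refine Set.ncard_le_ncard ?_ (Set.toFinite _)
      rintro x (rfl | rfl)
      · simp
      · exact (SimpleGraph.dist_eq_one_iff_adj.2 hw).le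
    rw [Set.ncard_pair hw.ne] at h2
    have : (2 : ℝ) ≤ ({w : V | T.dist v w ≤ 1}.ncard : ℝ) := by exact_mod_cast h2
    linarith
  · norm_num

theorem ncard_ball_le (hT : T.IsTree) (v : V) {s : ℕ} (hs : 1 ≤ s) :
    ({w : V | T.dist v w ≤ s}.ncard : ℝ) ≤ 2 * (2 * (s : ℝ) + 1) ^ rho T := by
  have key : ∀ s : ℕ, 1 ≤ s → s ≤ T.diam →
      ({w : V | T.dist v w ≤ s}.ncard : ℝ) ≤ 2 * (2 * (s : ℝ) + 1) ^ rho T := by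
    intro s hs hsd
    have hs' : (1 : ℝ) ≤ s := by exact_mod_cast hs
    have hpos : (0 : ℝ) < {w : V | T.dist v w ≤ s}.ncard := by
      have : 0 < {w : V | T.dist v w ≤ s}.ncard :=
        (Set.ncard_pos (Set.toFinite _)).2 ⟨v, by simp⟩
      exact_mod_cast this
    have h := le_rho T v hs hsd
    have hlog : 0 < Real.logb 2 (2 * (s : ℝ) + 1) := Real.logb_pos (by norm_num) (by linarith)
    rw [div_le_iff₀ hlog, Real.logb_le_iff_le_rpow (by norm_num) (by positivity), mul_comm,
      Real.rpow_mul (by norm_num), Real.rpow_logb (by norm_num) (by norm_num) (by linarith)] at h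
    linarith
  -- Beyond the diameter the ball no longer grows, while the bound still increases because `ρ ≥ 0`.
  rcases le_or_gt s T.diam with hsd | hsd
  · exact key s hs hsd
  · have h1 : ({w : V | T.dist v w ≤ s}.ncard : ℝ) ≤ {w : V | T.dist v w ≤ T.diam}.ncard := by
      exact_mod_cast Set.ncard_le_ncard
        (fun w _ => SimpleGraph.dist_le_diam (ediam_ne_top hT)) (Set.toFinite _)
    refine h1.trans ((key _ (one_le_diam hT) le_rfl).trans ?_)
    have : (T.diam : ℝ) ≤ s := by exact_mod_cast hsd.le
    have := rho_nonneg hT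
    gcongr

theorem card_component_le (hT : T.IsTree) {r : V} {X : Side} {i : ℕ}
    (F : (forest T r X i).ConnectedComponent) :
    (F.supp.ncard : ℝ) ≤ 2 * (6 * (scale T r i : ℝ) + 1) ^ rho T := by
  obtain ⟨c, hc⟩ := exists_isTop T r F
  have hs := scale_pos T r i
  have h := ncard_ball_le hT c (s := 3 * scale T r i) (by omega)
  have h2 : (F.supp.ncard : ℝ) ≤ {w : V | T.dist c w ≤ 3 * scale T r i}.ncard := by
    exact_mod_cast Set.ncard_le_ncard (fun w hw => hc.dist_le hT hw) (Set.toFinite _)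
  refine h2.trans (h.trans (le_of_eq ?_))
  push_cast
  ring_nf

end Balls

/-! ### Outputs of the procedure are separating -/

section Output

variable {V : Type u} {T : SimpleGraph V} {r : V} {G : SimpleGraph V} {F : G.ConnectedComponent}

theorem isTop_root (T : SimpleGraph V) (r : V) : IsTop T r (T.connectedComponentMk r) r :=
  ⟨rfl, fun w _ => by rw [depth_root]; exact Nat.zero_le _⟩

theorem mem_supp_root (hT : T.IsTree) (r v : V) : v ∈ (T.connectedComponentMk r).supp :=
  SimpleGraph.ConnectedComponent.sound (hT.connected.preconnected v r)

theorem IsTop.le_branch (hT : T.IsTree) (hG : G ≤ T) {c u v : V} (hc : IsTop T r F c)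
    (hu : u ∈ F.supp) (hv : v ∈ F.supp) {a : ℕ}
    (h : ∀ j, a < j → j ≤ depth T r u → j ≤ depth T r v → anc T r u j ≠ anc T r v j) :
    depth T r c ≤ a := by
  by_contra hlt
  have h1 := hc.anc_eq hT hG hu
  have h2 := hc.anc_eq hT hG hv
  exact h _ (not_le.1 hlt) h1.1 h2.1 (h1.2.trans h2.2.symm)

theorem ext0_extendZero (hG : G ≤ T) {d : ℕ} (W : WeightAssignment G d) {e : Sym2 V}
    (he : e ∈ G.edgeSet) (k : Fin d) : ext0 (extendZero T W) e k = ext0 W e k := by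
  rw [ext0_of_mem _ he, ext0_of_mem _ (SimpleGraph.edgeSet_mono hG he), extendZero, dif_pos he]

variable [Fintype V]

/-- The top of `F` is a common ancestor of `u` and `v`, so both branches below their branching
vertex stay inside `F`, where the two assignments agree. -/
theorem IsTop.pathSum_sub_eq_root (hT : T.IsTree) (hG : G ≤ T) {c u v : V} (hc : IsTop T r F c)
    (hu : u ∈ F.supp) (hv : v ∈ F.supp) {d : ℕ} (W : WeightAssignment G d)
    (W' : WeightAssignment T d) (hW : ∀ e ∈ G.edgeSet, ∀ k, ext0 W' e k = ext0 W e k) (k : Fin d) :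
    pathSum T W' r u k - pathSum T W' r v k = pathSum G W c u k - pathSum G W c v k := by
  obtain ⟨a, hau, hav, h1, h2, -⟩ := exists_branch hT r u v
  have hca := hc.le_branch hT hG hu hv h2
  rw [hc.pathSum_sub hT hG hu hv W k hca hau hav h1,
    (isTop_root T r).pathSum_sub hT le_rfl (mem_supp_root hT r u) (mem_supp_root hT r v) W' k
      (by rw [depth_root]; exact Nat.zero_le _) hau hav h1]
  congr 1
  · refine Finset.sum_congr rfl fun j hj => hW _ ?_ k
    rw [Finset.mem_Ioc] at hj
    exact hc.ancEdge_mem hT hG hu (by omega) hj.2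
  · refine Finset.sum_congr rfl fun j hj => hW _ ?_ k
    rw [Finset.mem_Ioc] at hj
    exact hc.ancEdge_mem hT hG hv (by omega) hj.2

theorem pathSum_concat4 {t : ℕ} (W : Fin 4 → WeightAssignment G t) (a b : V) (m : Fin 4)
    (k : Fin t) :
    pathSum G (concat4 (W 0) (W 1) (W 2) (W 3)) a b (finProdFinEquiv (m, k)) =
      pathSum G (W m) a b k := by
  have : ![W 0, W 1, W 2, W 3] = W := by
    funext i
    fin_cases i <;> rfl
  simp only [pathSum, concat4, Equiv.symm_apply_apply, this]

theorem sum_Ioc_sub (φ g : ℕ → ℝ) {m n : ℕ} (hmn : m ≤ n)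
    (h : ∀ j, m < j → j ≤ n → g j = φ j - φ (j - 1)) :
    ∑ j ∈ Finset.Ioc m n, g j = φ n - φ m := by
  induction n, hmn using Nat.le_induction with
  | base => simp
  | succ n hmn ih =>
    rw [Finset.sum_Ioc_succ_top (by omega), ih fun j h1 h2 => h j h1 (by omega),
      h (n + 1) (by omega) le_rfl, Nat.add_sub_cancel]
    ring

theorem IsBase.pathSum_sub {X : Side} {i t : ℕ} (hT : T.IsTree)
    {W : WeightAssignment (forest T r X i) t} {F : (forest T r X i).ConnectedComponent}
    {f : F → Fin t → ℝ}
    (hf : ∀ (u v : F) (huv : (forest T r X i).Adj u v), depth T r u = depth T r v + 1 →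
      ∀ k, (W ⟨s((u : V), (v : V)), huv⟩ k : ℝ) = f u k - f v k)
    {c : V} (hc : IsTop T r F c) (u v : F) (k : Fin t) :
    pathSum (forest T r X i) W c u k - pathSum (forest T r X i) W c v k = f u k - f v k := by
  classical
  have hG := forest_le T r X i
  have key : ∀ u : F, pathSum (forest T r X i) W c u k = f u k - f ⟨c, hc.1⟩ k := by
    intro u
    have hcu := hc.anc_eq hT hG u.2
    let φ : ℕ → ℝ := fun j => if h : anc T r u j ∈ F.supp then f ⟨anc T r u j, h⟩ k else 0
    have hφ : ∀ {j : ℕ} {x : V} (hx : x ∈ F.supp), anc T r u j = x → φ j = f ⟨x, hx⟩ k := by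
      rintro j x hx rfl
      exact dif_pos hx
    rw [hc.pathSum_eq hT hG u.2, sum_Ioc_sub φ _ hcu.1, hφ u.2 (anc_depth _), hφ hc.1 hcu.2]
    rintro j h1 h2
    obtain ⟨j, rfl⟩ : ∃ i, j = i + 1 := ⟨j - 1, by omega⟩
    have m1 := hc.anc_mem hT hG u.2 (j := j) (by omega) (by omega)
    have m2 := hc.anc_mem hT hG u.2 h1.le h2
    have he := hc.ancEdge_mem hT hG u.2 h1 h2
    rw [Nat.add_sub_cancel, hφ m1 rfl, hφ m2 rfl, ext0_of_mem _ he]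
    have heq : ancEdge T r u (j + 1) = s(anc T r u (j + 1), anc T r u j) := by
      rw [ancEdge, par_anc (by omega), Sym2.eq_swap]
    have he' : (forest T r X i).Adj (anc T r u (j + 1)) (anc T r u j) := by
      rwa [heq, SimpleGraph.mem_edgeSet] at he
    rw [← hf ⟨_, m2⟩ ⟨_, m1⟩ he' (by
      rw [depth_anc hT h2, depth_anc hT (by omega)])]
    have : (⟨ancEdge T r u (j + 1), he⟩ : (forest T r X i).edgeSet) =
        ⟨s(anc T r u (j + 1), anc T r u j), he'⟩ :=
      Subtype.ext heq
    rw [this]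
  rw [key u, key v]
  ring

theorem IsBase.one_lt_norm {X : Side} {i t : ℕ} (hT : T.IsTree)
    {W : WeightAssignment (forest T r X i) t} (hW : IsBase T r X i W)
    {F : (forest T r X i).ConnectedComponent} {c u v : V} (hc : IsTop T r F c) (hu : u ∈ F.supp)
    (hv : v ∈ F.supp) (huv : u ≠ v) (hn : ¬ (forest T r X i).Adj u v) :
    1 < ‖pathSum (forest T r X i) W c u - pathSum (forest T r X i) W c v‖ := by
  obtain ⟨f, hf, hfW⟩ := hW F
  have h : pathSum (forest T r X i) W c u - pathSum (forest T r X i) W c v =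
      f ⟨u, hu⟩ - f ⟨v, hv⟩ := by
    funext k
    exact IsBase.pathSum_sub hT hfW hc ⟨u, hu⟩ ⟨v, hv⟩ k
  rw [h]
  rw [isCubeRep_iff] at hf
  have := hf ⟨u, hu⟩ ⟨v, hv⟩ (fun h => huv (congrArg Subtype.val h))
  rw [SimpleGraph.ConnectedComponent.toSimpleGraph_adj] at this
  exact not_le.1 fun h => hn (this.2 h)

theorem ext0_extend {X : Side} {i t : ℕ} {W : WeightAssignment (forest T r X (i + 2)) t}
    {ω : (forest T r X i).edgeSet → Fin t → Bool} {e : Sym2 V}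
    (he : e ∈ (forest T r X i).edgeSet) (he2 : e ∈ (forest T r X (i + 2)).edgeSet) (k : Fin t) :
    ext0 (extend T r X i W ω) e k = ext0 W e k := by
  rw [ext0_of_mem _ he, ext0_of_mem _ he2, extend, dif_pos he2]

theorem ProcedureRun.ext0_eq (hT : T.IsTree) (R : ProcedureRun T r) (X : Side) (p n : ℕ)
    (hn : p + 2 * n ≤ max (evenIdx T r) (oddIdx T r)) :
    forest T r X (p + 2 * n) ≤ forest T r X p ∧ ∀ e ∈ (forest T r X (p + 2 * n)).edgeSet, ∀ k,
      ext0 (R.W X p) e k = ext0 (R.W X (p + 2 * n)) e k := by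
  induction n with
  | zero => exact ⟨le_rfl, fun _ _ _ => rfl⟩
  | succ n ih =>
    obtain ⟨ih1, ih2⟩ := ih (by omega)
    have hstep : p + 2 * n + 2 ≤ max (evenIdx T r) (oddIdx T r) := hn
    have hle := forest_mono hT X (scale_gt_of_add_two_le hstep)
    refine ⟨hle.trans ih1, fun e he k => ?_⟩
    have he' := SimpleGraph.edgeSet_mono hle he
    obtain ⟨⟨ω, hω⟩, -⟩ := R.step X (p + 2 * n) hstep
    rw [ih2 e he' k, hω]
    exact ext0_extend he' he k

theorem ProcedureRun.exists_one_lt (hT : T.IsTree) (R : ProcedureRun T r) {u v : V} (huv : u ≠ v)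
    (hn : ¬ T.Adj u v) :
    ∃ (X : Side) (i : ℕ) (F : (forest T r X i).ConnectedComponent) (c : V),
      i ≤ max (evenIdx T r) (oddIdx T r) ∧ IsTop T r F c ∧ u ∈ F.supp ∧ v ∈ F.supp ∧
      1 < ‖pathSum (forest T r X i) (R.W X i) c u - pathSum (forest T r X i) (R.W X i) c v‖ := by
  classical
  obtain ⟨m, -, -, hm⟩ := exists_idx T r
  have hmax : max (evenIdx T r) (oddIdx T r) = m + 1 := by
    rcases hm with ⟨h1, h2⟩ | ⟨h1, h2⟩ <;> rw [h1, h2] <;> simp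
  have hreach : ∀ i, T.dist u v ≤ scale T r i ∨ i = 0 →
      ∃ X, ∃ F : (forest T r X i).ConnectedComponent, u ∈ F.supp ∧ v ∈ F.supp := by
    intro i hi
    have : ∃ X, (forest T r X i).Reachable u v := by
      rcases hi with hi | rfl
      · exact exists_forest_reachable hT r i hi
      · refine ⟨Side.A, ?_⟩
        rw [forest_zero]
        exact hT.connected.preconnected u v
    obtain ⟨X, hX⟩ := this
    exact ⟨X, (forest T r X i).connectedComponentMk u, rfl,
      SimpleGraph.ConnectedComponent.sound hX.symm⟩
  have hnf : ∀ X i, ¬ (forest T r X i).Adj u v := fun X i h => hn (forest_le T r X i h)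
  by_cases hb : T.dist u v ≤ scale T r m ∨ m = 0
  · obtain ⟨X, F, hu, hv⟩ := hreach m hb
    obtain ⟨c, hc⟩ := exists_isTop T r F
    have hbase : IsBase T r X m (R.W X m) := by
      rcases hm with ⟨h1, -⟩ | ⟨h1, -⟩
      · exact h1 ▸ R.base_even X
      · exact h1 ▸ R.base_odd X
    exact ⟨X, m, F, c, by omega, hc, hu, hv, hbase.one_lt_norm hT hc hu hv huv (hnf X m)⟩
  · push Not at hb
    have hex : ∃ i, scale T r i < T.dist u v := ⟨m, hb.1⟩
    have hspec := Nat.find_spec hex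
    have hle : Nat.find hex ≤ m := Nat.find_min' hex hb.1
    -- If even `h_0` is smaller than the distance, the truncated subtraction gives `i = 0`, where
    -- nothing is cut.
    obtain ⟨i, hi⟩ : ∃ i, i = Nat.find hex - 1 := ⟨_, rfl⟩
    have hi2 : scale T r (i + 1) ≤ T.dist u v :=
      (scale_anti T r (by omega)).trans hspec.le
    obtain ⟨X, F, hu, hv⟩ := hreach i (by
      rcases Nat.eq_zero_or_pos (Nat.find hex) with h0 | h0
      · right; omega
      · left; exact not_lt.1 (Nat.find_min hex (by omega)))
    obtain ⟨c, hc⟩ := exists_isTop T r F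
    have hacc := (R.step X i (by omega)).2 F
    exact ⟨X, i, F, c, by omega, hc, hu, hv, hacc c hc.1 hc.2 u hu v hv huv (hnf X i) hi2⟩

theorem exists_one_lt_of_norm {d : ℕ} {x : Fin d → ℝ} (h : 1 < ‖x‖) : ∃ k, 1 < |x k| := by
  by_contra hn
  push Not at hn
  exact not_le.2 h ((pi_norm_le_iff_of_nonneg zero_le_one).2 hn)

theorem one_lt_norm_of_exists {d : ℕ} {x : Fin d → ℝ} {k : Fin d} (h : 1 < |x k|) : 1 < ‖x‖ :=
  h.trans_le (norm_le_pi_norm x k)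

theorem ProcedureRun.separates (hT : T.IsTree) (R : ProcedureRun T r) {u v : V} (huv : u ≠ v)
    (hn : ¬ T.Adj u v) : Separates T r R.output u v := by
  obtain ⟨X, i, F, c, hi, hc, hu, hv, h⟩ := R.exists_one_lt hT huv hn
  obtain ⟨k, hk⟩ := exists_one_lt_of_norm h
  -- The parity of `i` decides whether the vectors end up in `W_0` or in `W'_0`.
  obtain ⟨n, hn⟩ : ∃ n, i = i % 2 + 2 * n := ⟨i / 2, by omega⟩
  have hlt := Nat.mod_lt i (y := 2) (by norm_num)
  generalize i % 2 = p at hn hlt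
  subst hn
  obtain ⟨h1, h2⟩ := R.ext0_eq hT X p n hi
  have key : pathSum T (extendZero T (R.W X p)) r u k - pathSum T (extendZero T (R.W X p)) r v k =
      pathSum (forest T r X (p + 2 * n)) (R.W X (p + 2 * n)) c u k -
      pathSum (forest T r X (p + 2 * n)) (R.W X (p + 2 * n)) c v k := by
    refine hc.pathSum_sub_eq_root hT (forest_le T r X _) hu hv _ _ (fun e he k => ?_) k
    rw [ext0_extendZero (forest_le T r X p) _ (SimpleGraph.edgeSet_mono h1 he), h2 e he]
  let W : Fin 4 → WeightAssignment T (tdim T) := ![extendZero T (R.W Side.A 0),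
    extendZero T (R.W Side.B 0), extendZero T (R.W Side.A 1), extendZero T (R.W Side.B 1)]
  have hW : ∃ m, W m = extendZero T (R.W X p) := by
    interval_cases p <;> cases X
    exacts [⟨0, rfl⟩, ⟨1, rfl⟩, ⟨2, rfl⟩, ⟨3, rfl⟩]
  obtain ⟨m, hm⟩ := hW
  have hout : R.output = concat4 (W 0) (W 1) (W 2) (W 3) := rfl
  refine one_lt_norm_of_exists (k := finProdFinEquiv (m, k)) ?_
  rw [Pi.sub_apply, hout, pathSum_concat4, pathSum_concat4, hm, key]
  exact hk

theorem abs_pathSum_sub_le_of_adj (hT : T.IsTree) {d : ℕ} (W : WeightAssignment T d) {u v : V}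
    (h : T.Adj u v) (k : Fin d) : |pathSum T W r u k - pathSum T W r v k| ≤ 1 := by
  have key : ∀ u v, T.Adj u v → depth T r u = depth T r v + 1 →
      |pathSum T W r u k - pathSum T W r v k| ≤ 1 := by
    intro u v h hd
    have hpar := par_eq hT h.symm hd
    rw [(isTop_root T r).pathSum_sub hT le_rfl (mem_supp_root hT r u) (mem_supp_root hT r v) W k
      (a := depth T r v) (by rw [depth_root]; exact Nat.zero_le _) (by omega) le_rfl
      (fun j hj => by rw [← anc_par hT (by omega) (by omega), hpar])]
    rw [hd, Finset.sum_Ioc_succ_top le_rfl, Finset.Ioc_self, Finset.sum_empty, Finset.sum_empty,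
      zero_add, sub_zero, ext0]
    split_ifs with he
    · rw [abs_le]
      exact (W ⟨_, he⟩ k).2
    · simp
  rcases depth_adj hT r h with hd | hd
  · rw [abs_sub_comm]
    exact key v u h.symm hd
  · exact key u v h hd

theorem ProcedureRun.isCubeRep (hT : T.IsTree) (R : ProcedureRun T r) :
    IsCubeRep T fun v => pathSum T R.output r v := by
  rw [isCubeRep_iff]
  intro u v huv
  constructor
  · intro h
    rw [pi_norm_le_iff_of_nonneg zero_le_one]
    exact fun k => abs_pathSum_sub_le_of_adj hT R.output h k
  · intro h
    by_contra hn
    exact not_lt.2 h (R.separates hT huv hn)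

end Output

/-! ### The success probability of a random extension -/

section Probability

variable {V : Type u} [Fintype V] {T : SimpleGraph V} {r : V} {X : Side} {i : ℕ}
  {F : (forest T r X i).ConnectedComponent}

-- The edges that receive random vectors are those just below the cut depths of level `i + 2`, so
-- `card_cutDepth` counts them.
open Classical in
theorem card_random_edges (hT : T.IsTree) {c u : V} (hc : IsTop T r F c) (hu : u ∈ F.supp) {a : ℕ}
    (hca : depth T r c ≤ a) :
    depth T r u ≤ a + 3 * scale T r (i + 2) * (((Finset.univ.filter
      (fun e : (forest T r X i).edgeSet => ∃ j, a < j ∧ j ≤ depth T r u ∧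
        (e : Sym2 V) = ancEdge T r u j)).filter
      (fun e : (forest T r X i).edgeSet => (e : Sym2 V) ∉ (forest T r X (i + 2)).edgeSet)).card +
        1) := by
  refine (card_cutDepth X (scale_pos T r (i + 2)) a (depth T r u)).trans ?_
  gcongr a + _ * (?_ + 1)
  rw [← Finset.card_image_of_injOn (f := fun j => ancEdge T r u (j + 1))]
  · refine (Finset.card_le_card ?_).trans (Finset.card_image_le (f := Subtype.val))
    intro e he
    obtain ⟨j, hj, rfl⟩ := Finset.mem_image.1 he
    rw [Finset.mem_filter, Finset.mem_Ico] at hj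
    have hmem := hc.ancEdge_mem hT (forest_le T r X i) hu (j := j + 1) (by omega) (by omega)
    refine Finset.mem_image.2 ⟨⟨_, hmem⟩, ?_, rfl⟩
    rw [Finset.mem_filter, Finset.mem_filter, ancEdge_mem_forest_iff hT X _ (by omega), not_not]
    exact ⟨⟨Finset.mem_univ _, j + 1, by omega, by omega, rfl⟩, hj.2⟩
  · intro j hj j' hj' h
    rw [Finset.mem_coe, Finset.mem_filter, Finset.mem_Ico] at hj hj'
    have := (ancEdge_eq_iff hT (by omega) (by omega) (by omega) (by omega)).1 h
    omega

/-- The probability that a fixed pair of vertices is not separated by a random extension. -/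
theorem ncard_not_separated_le (hT : T.IsTree) {t : ℕ}
    (W : WeightAssignment (forest T r X (i + 2)) t) {c u v : V} (hc : IsTop T r F c)
    (hu : u ∈ F.supp) (hv : v ∈ F.supp) :
    ∃ m, T.dist u v ≤ 3 * scale T r (i + 2) * (m + 2) ∧
      ({ω | ‖pathSum (forest T r X i) (extend T r X i W ω) c u -
        pathSum (forest T r X i) (extend T r X i W ω) c v‖ ≤ 1}.ncard : ℝ) ≤
      signProb m ^ t * Nat.card ((forest T r X i).edgeSet → Fin t → Bool) := by
  classical
  have hG := forest_le T r X i
  obtain ⟨a, hau, hav, h1, h2, hdist⟩ := exists_branch hT r u v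
  have hca := hc.le_branch hT hG hu hv h2
  let E := (forest T r X i).edgeSet
  let P : E → Prop := fun e => (e : Sym2 V) ∉ (forest T r X (i + 2)).edgeSet
  let A : V → Finset E := fun u => Finset.univ.filter (fun e : E => ∃ j, a < j ∧
    j ≤ depth T r u ∧ (e : Sym2 V) = ancEdge T r u j)
  have hcu := card_random_edges hT hc hu hca
  have hcv := card_random_edges hT hc hv hca
  have hdisj : Disjoint (A u) (A v) := by
    rw [Finset.disjoint_left]
    intro e he he'
    obtain ⟨j, j1, j2, j3⟩ := (Finset.mem_filter.1 he).2
    obtain ⟨j', j1', j2', j3'⟩ := (Finset.mem_filter.1 he').2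
    rw [j3, ancEdge_eq_iff hT (by omega) (by omega) j2 j2'] at j3'
    obtain ⟨rfl, h3⟩ := j3'
    exact h2 j j1 j2 j2' h3
  have hdisj' : Disjoint ((A u).filter P) ((A v).filter P) :=
    Finset.disjoint_filter_filter hdisj
  let M : Finset E := (A u).filter P ∪ (A v).filter P
  have hM : M.card = ((A u).filter P).card + ((A v).filter P).card :=
    Finset.card_union_of_disjoint hdisj'
  -- Random edges on the branch towards `v` enter the difference with a minus sign; `x` collects the
  -- inherited vectors. Each branch loses one in the counting, whence `m + 2`.
  let ε : E → ℝ := fun e => if e ∈ A u then 1 else -1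
  let x : (E → Fin t → Bool) → Fin t → ℝ := fun ω k =>
    ∑ e ∈ (A u).filter (fun e => ¬ P e), ext0 W e k -
      ∑ e ∈ (A v).filter (fun e => ¬ P e), ext0 W e k
  have hsum : ∀ (ω : E → Fin t → Bool) (u : V) (k : Fin t),
      ∑ e ∈ A u, (extend T r X i W ω e k : ℝ) =
      ∑ e ∈ (A u).filter P, (bitSign (ω e k) : ℝ) +
        ∑ e ∈ (A u).filter (fun e => ¬ P e), ext0 W e k := by
    intro ω u k
    rw [← Finset.sum_filter_add_sum_filter_not (A u) P]
    congr 1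
    · refine Finset.sum_congr rfl fun e he => ?_
      have he' : (e : Sym2 V) ∉ (forest T r X (i + 2)).edgeSet := (Finset.mem_filter.1 he).2
      rw [extend, dif_neg he']
    · refine Finset.sum_congr rfl fun e he => ?_
      have he' : (e : Sym2 V) ∈ (forest T r X (i + 2)).edgeSet :=
        not_not.1 (Finset.mem_filter.1 he).2
      rw [extend, dif_pos he', ext0_of_mem _ he']
  have hkey : ∀ (ω : E → Fin t → Bool) (k : Fin t),
      pathSum (forest T r X i) (extend T r X i W ω) c u k -
        pathSum (forest T r X i) (extend T r X i W ω) c v k =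
      x ω k + ∑ e ∈ M, ε e * (bitSign (ω e k) : ℝ) := by
    intro ω k
    rw [hc.pathSum_sub hT hG hu hv _ k hca hau hav h1,
      hc.sum_filter_ancEdge hT hG hu _ k hca, hc.sum_filter_ancEdge hT hG hv _ k hca]
    change ∑ e ∈ A u, (extend T r X i W ω e k : ℝ) - ∑ e ∈ A v, (extend T r X i W ω e k : ℝ) = _
    rw [hsum, hsum, Finset.sum_union hdisj']
    have e1 : ∑ e ∈ (A u).filter P, ε e * (bitSign (ω e k) : ℝ) =
        ∑ e ∈ (A u).filter P, (bitSign (ω e k) : ℝ) := by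
      refine Finset.sum_congr rfl fun e he => ?_
      simp only [ε]
      rw [if_pos (Finset.mem_filter.1 he).1, one_mul]
    have e2 : ∑ e ∈ (A v).filter P, ε e * (bitSign (ω e k) : ℝ) =
        -∑ e ∈ (A v).filter P, (bitSign (ω e k) : ℝ) := by
      rw [← Finset.sum_neg_distrib]
      refine Finset.sum_congr rfl fun e he => ?_
      simp only [ε]
      rw [if_neg (Finset.disjoint_right.1 hdisj (Finset.mem_filter.1 he).1), neg_one_mul]
    rw [e1, e2]
    simp only [x]
    ring
  refine ⟨M.card, ?_, ?_⟩
  · rw [hM]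
    change depth T r u ≤ a + 3 * scale T r (i + 2) * (((A u).filter P).card + 1) at hcu
    change depth T r v ≤ a + 3 * scale T r (i + 2) * (((A v).filter P).card + 1) at hcv
    calc T.dist u v ≤ (depth T r u - a) + (depth T r v - a) := hdist
      _ ≤ 3 * scale T r (i + 2) * (((A u).filter P).card + 1) +
          3 * scale T r (i + 2) * (((A v).filter P).card + 1) := by omega
      _ = _ := by ring
  · have h := card_forall_sign_sum_le M ε (fun e _ => by simp only [ε]; split_ifs <;> simp) x
      (fun _ _ _ => rfl)
    rw [Nat.card_eq_fintype_card]
    refine le_trans (le_of_eq ?_) h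
    rw [← Set.ncard_coe_finset]
    congr 2
    ext ω
    simp only [Set.mem_ofPred_eq, Finset.mem_coe, Finset.mem_filter, Finset.mem_univ, true_and,
      pi_norm_le_iff_of_nonneg zero_le_one, Pi.sub_apply, Real.norm_eq_abs, hkey ω]

/-- The powers of `q` are `4 + 2` against `11`. The surplus `q^5 ≥ 256^5` absorbs the constant `35 ·
(256/31)^11`, where `256/31` bounds `8q/(q-6)`. -/
theorem pow_mul_growth_le_one {q y : ℝ} (hq : 256 ≤ q) (hy : 1 ≤ y) :
    (6 * q ^ 4 + 1) * (4 * (y * q ^ 2) + 1) * (8 / (y * (q - 6))) ^ 11 ≤ 1 := by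
  have hy0 : 0 < y := by linarith
  have hq0 : 0 < q := by linarith
  have h1 : 8 / (y * (q - 6)) ≤ (256 / 31) / (y * q) := by
    rw [div_le_div_iff₀ (by nlinarith) (by positivity)]
    nlinarith
  have h0 : 0 ≤ 8 / (y * (q - 6)) := div_nonneg (by norm_num) (by nlinarith)
  have h2 : 6 * q ^ 4 + 1 ≤ 7 * q ^ 4 := by
    have : 1 ≤ q ^ 4 := one_le_pow₀ (by linarith)
    linarith
  have h3 : 4 * (y * q ^ 2) + 1 ≤ 5 * (y * q ^ 2) := by
    have : 1 ≤ q ^ 2 := one_le_pow₀ (by linarith)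
    nlinarith
  calc (6 * q ^ 4 + 1) * (4 * (y * q ^ 2) + 1) * (8 / (y * (q - 6))) ^ 11
      ≤ 7 * q ^ 4 * (5 * (y * q ^ 2)) * ((256 / 31) / (y * q)) ^ 11 := by gcongr
    _ = (35 * (256 / 31) ^ 11) * (y * q ^ 6) / (y * q) ^ 11 := by rw [div_pow]; ring
    _ ≤ 1 := by
      rw [div_le_one (by positivity)]
      have h4 : (256 : ℝ) ^ 5 ≤ q ^ 5 := by gcongr
      have h5 : (1 : ℝ) ≤ y ^ 10 := one_le_pow₀ hy
      have h6 : 35 * (256 / 31 : ℝ) ^ 11 ≤ y ^ 10 * q ^ 5 := by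
        have h7 : 1 * (256 : ℝ) ^ 5 ≤ y ^ 10 * q ^ 5 := by gcongr
        refine le_trans ?_ h7
        norm_num
      calc (35 * (256 / 31) ^ 11) * (y * q ^ 6) ≤ (y ^ 10 * q ^ 5) * (y * q ^ 6) := by gcongr
        _ = (y * q) ^ 11 := by ring

theorem pow_le_of_sq_le {p x ρ : ℝ} {t : ℕ} (hp : 0 ≤ p) (hx0 : 0 < x) (hx1 : x ≤ 1)
    (hpx : p ^ 2 ≤ x) (ht : 22 * ρ + 2 ≤ t) : p ^ t ≤ x * (x ^ 11) ^ ρ := by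
  have h1 : x * (x ^ 11) ^ ρ = x ^ (11 * ρ + 1) := by
    rw [Real.rpow_add hx0, Real.rpow_one, Real.rpow_mul hx0.le, mul_comm]
    norm_cast
  rw [h1, ← sq_le_sq₀ (by positivity) (by positivity), ← pow_mul, mul_comm t 2, pow_mul]
  calc (p ^ 2) ^ t ≤ x ^ t := by gcongr
    _ = x ^ (t : ℝ) := (Real.rpow_natCast x t).symm
    _ ≤ x ^ (22 * ρ + 2) := Real.rpow_le_rpow_of_exponent_ge hx0 hx1 ht
    _ = (x ^ (11 * ρ + 1)) ^ 2 := by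
      rw [← Real.rpow_natCast (x ^ (11 * ρ + 1)), ← Real.rpow_mul hx0.le]
      congr 1
      push_cast
      ring

theorem le_tdim {V : Type u} [Fintype V] [Nontrivial V] {T : SimpleGraph V} (hT : T.IsTree) :
    22 * rho T + 2 ≤ tdim T := by
  have h := Nat.le_ceil ((22.77 : ℝ) * rho T)
  have := rho_nonneg hT
  rw [tdim]
  push_cast
  norm_num at h ⊢
  linarith

theorem ncard_not_separated_le_of_dist [Nontrivial V] (hT : T.IsTree)
    (W : WeightAssignment (forest T r X (i + 2)) (tdim T)) {c u v : V} (hc : IsTop T r F c)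
    (hu : u ∈ F.supp) (hv : v ∈ F.supp) {q j : ℕ} (hq : 256 ≤ q) (hs : scale T r (i + 2) = q)
    (hd : 2 ^ j * q ^ 2 ≤ T.dist u v) :
    ({ω | ‖pathSum (forest T r X i) (extend T r X i W ω) c u -
        pathSum (forest T r X i) (extend T r X i W ω) c v‖ ≤ 1}.ncard : ℝ) ≤
      8 / (2 ^ j * ((q : ℝ) - 6)) * ((8 / (2 ^ j * ((q : ℝ) - 6))) ^ 11) ^ rho T *
        Nat.card ((forest T r X i).edgeSet → Fin (tdim T) → Bool) := by
  obtain ⟨m, hm, hle⟩ := ncard_not_separated_le hT W hc hu hv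
  refine hle.trans (mul_le_mul_of_nonneg_right ?_ (Nat.cast_nonneg _))
  rw [hs] at hm
  have h1 : 2 ^ j * q ≤ 3 * (m + 2) := by
    refine Nat.le_of_mul_le_mul_left (?_ : q * _ ≤ q * _) (by omega)
    calc q * (2 ^ j * q) = 2 ^ j * q ^ 2 := by ring
      _ ≤ 3 * q * (m + 2) := hd.trans hm
      _ = q * (3 * (m + 2)) := by ring
  have hq' : (256 : ℝ) ≤ q := by exact_mod_cast hq
  have hy : (1 : ℝ) ≤ 2 ^ j := one_le_pow₀ (by norm_num)
  have h2 : (2 ^ j * q : ℝ) ≤ 3 * (m + 2) := by exact_mod_cast h1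
  -- The loss of `6` from `3(m + 2)` is at most `6 · 2^j`.
  have h3 : (2 : ℝ) ^ j * (q - 6) ≤ 3 * m := by nlinarith
  have h4 : (250 : ℝ) ≤ 2 ^ j * (q - 6) := by nlinarith
  have hm0 : 0 < m := by
    rcases Nat.eq_zero_or_pos m with rfl | h
    · norm_num at h3
      linarith
    · exact h
  refine pow_le_of_sq_le (signProb_nonneg m) (by positivity) ?_ ?_ (le_tdim hT)
  · rw [div_le_one (by linarith)]
    linarith
  · refine (signProb_sq_le hm0).trans ?_
    gcongr

theorem extend_accepts_prob [Nontrivial V] (hT : T.IsTree) (h : 2 ^ 16 < scale T r i)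
    (W : WeightAssignment (forest T r X (i + 2)) (tdim T))
    (F : (forest T r X i).ConnectedComponent) :
    (0.64 : ℝ) * Nat.card ((forest T r X i).edgeSet → Fin (tdim T) → Bool) ≤
      {ω | Accepts T r X i (extend T r X i W ω) F}.ncard := by
  classical
  obtain ⟨q, hq, -, hs2, hs1, hs0⟩ := exists_scale_eq h
  obtain ⟨c, hc⟩ := exists_isTop T r F
  set N : ℝ := (Nat.card ((forest T r X i).edgeSet → Fin (tdim T) → Bool) : ℝ) with hN
  have hq' : (256 : ℝ) ≤ q := by exact_mod_cast hq
  have hρ := rho_nonneg hT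
  let Ω := (forest T r X i).edgeSet → Fin (tdim T) → Bool
  let B : V → V → Set Ω := fun u v =>
    {ω | ‖pathSum (forest T r X i) (extend T r X i W ω) c u -
      pathSum (forest T r X i) (extend T r X i W ω) c v‖ ≤ 1}
  let S : Finset V := Finset.univ.filter (· ∈ F.supp)
  let D : ℕ → V → Finset V := fun j u => Finset.univ.filter fun v => v ∈ F.supp ∧
    2 ^ j * q ^ 2 ≤ T.dist u v ∧ T.dist u v ≤ 2 * (2 ^ j * q ^ 2)
  let U : Finset Ω := (Finset.range (T.diam + 1)).biUnion fun j => S.biUnion fun u =>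
    (D j u).biUnion fun v => (B u v).toFinset
  have hcover : ∀ ω, ¬ Accepts T r X i (extend T r X i W ω) F → ω ∈ U := by
    intro ω hω
    unfold Accepts at hω
    push Not at hω
    obtain ⟨c', hc', hmin, u, hu, v, hv, -, -, hd, hle⟩ := hω
    obtain rfl : c' = c := IsTop.unique hT (forest_le T r X i) ⟨hc', hmin⟩ hc
    rw [hs1] at hd
    have hq2 : 0 < q ^ 2 := by positivity
    have hpos : T.dist u v / q ^ 2 ≠ 0 := (Nat.div_pos hd hq2).ne'
    -- The dyadic class of the distance measured in units of `h_{i+1} = q^2`.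
    obtain ⟨j, hj⟩ : ∃ j, j = Nat.log 2 (T.dist u v / q ^ 2) := ⟨_, rfl⟩
    have hj1 : 2 ^ j ≤ T.dist u v / q ^ 2 := by rw [hj]; exact Nat.pow_log_le_self 2 hpos
    have hj2 : T.dist u v / q ^ 2 < 2 ^ (j + 1) := by
      rw [hj]; exact Nat.lt_pow_succ_log_self (by norm_num) _
    have hjd : j < T.diam + 1 := by
      have h1 : j < 2 ^ j := Nat.lt_two_pow_self
      have h2 := Nat.div_le_self (T.dist u v) (q ^ 2)
      have h3 : T.dist u v ≤ T.diam := SimpleGraph.dist_le_diam (ediam_ne_top hT)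
      omega
    simp only [U, S, D, B, Finset.mem_biUnion, Finset.mem_range, Finset.mem_filter,
      Finset.mem_univ, true_and, Set.mem_toFinset]
    refine ⟨j, hjd, u, hu, v, ⟨hv, (Nat.le_div_iff_mul_le hq2).1 hj1, ?_⟩, hle⟩
    rw [Nat.div_lt_iff_lt_mul hq2, pow_succ] at hj2
    linarith
  have hSc : (S.card : ℝ) ≤ 2 * (6 * (q : ℝ) ^ 4 + 1) ^ rho T := by
    have h1 := card_component_le hT F
    rw [hs0] at h1
    push_cast at h1
    refine le_trans (le_of_eq ?_) h1
    rw [← Set.ncard_coe_finset]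
    congr 2
    ext v
    simp [S]
  have hDc : ∀ j u, ((D j u).card : ℝ) ≤ 2 * (4 * (2 ^ j * (q : ℝ) ^ 2) + 1) ^ rho T := by
    intro j u
    have hpos : 1 ≤ 2 * (2 ^ j * q ^ 2) := by
      have : 0 < 2 ^ j * q ^ 2 := by positivity
      omega
    have h1 := ncard_ball_le hT u hpos
    have h2 : (D j u).card ≤ {w : V | T.dist u w ≤ 2 * (2 ^ j * q ^ 2)}.ncard := by
      rw [← Set.ncard_coe_finset]
      refine Set.ncard_le_ncard (fun v hv => ?_) (Set.toFinite _)
      exact (Finset.mem_filter.1 hv).2.2.2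
    refine (Nat.cast_le.2 h2).trans (h1.trans (le_of_eq ?_))
    push_cast
    ring_nf
  have hUj : ∀ j, ((S.biUnion fun u => (D j u).biUnion fun v => (B u v).toFinset).card : ℝ) ≤
      0.128 * (1 / 2) ^ j * N := by
    intro j
    have hy : (1 : ℝ) ≤ 2 ^ j := one_le_pow₀ (by norm_num)
    have hx250 : (0 : ℝ) < 2 ^ j * (q - 6) := by nlinarith
    set x : ℝ := 8 / (2 ^ j * ((q : ℝ) - 6)) with hx
    have hx0 : 0 < x := by positivity
    have hB : ∀ u ∈ S, ∀ v ∈ D j u, ((B u v).toFinset.card : ℝ) ≤ x * (x ^ 11) ^ rho T * N := by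
      intro u hu v hv
      rw [← Set.ncard_eq_toFinset_card']
      exact ncard_not_separated_le_of_dist hT W hc (Finset.mem_filter.1 hu).2
        (Finset.mem_filter.1 hv).2.1 hq hs2 (Finset.mem_filter.1 hv).2.2.1
    have hgrow := pow_mul_growth_le_one hq' hy
    rw [← hx] at hgrow
    have hNn : 0 ≤ N := Nat.cast_nonneg _
    calc ((S.biUnion fun u => (D j u).biUnion fun v => (B u v).toFinset).card : ℝ)
        ≤ ∑ u ∈ S, ∑ v ∈ D j u, ((B u v).toFinset.card : ℝ) := by
          have h1 : (S.biUnion fun u => (D j u).biUnion fun v => (B u v).toFinset).card ≤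
              ∑ u ∈ S, ∑ v ∈ D j u, (B u v).toFinset.card :=
            Finset.card_biUnion_le.trans (Finset.sum_le_sum fun u _ => Finset.card_biUnion_le)
          exact_mod_cast h1
      _ ≤ ∑ u ∈ S, ∑ v ∈ D j u, x * (x ^ 11) ^ rho T * N :=
          Finset.sum_le_sum fun u hu => Finset.sum_le_sum fun v hv => hB u hu v hv
      _ ≤ ∑ u ∈ S, 2 * (4 * (2 ^ j * (q : ℝ) ^ 2) + 1) ^ rho T * (x * (x ^ 11) ^ rho T * N) := by
          refine Finset.sum_le_sum fun u _ => ?_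
          rw [Finset.sum_const, nsmul_eq_mul]
          exact mul_le_mul_of_nonneg_right (hDc j u) (by positivity)
      _ ≤ 2 * (6 * (q : ℝ) ^ 4 + 1) ^ rho T *
          (2 * (4 * (2 ^ j * (q : ℝ) ^ 2) + 1) ^ rho T * (x * (x ^ 11) ^ rho T * N)) := by
          rw [Finset.sum_const, nsmul_eq_mul]
          exact mul_le_mul_of_nonneg_right hSc (by positivity)
      _ = 4 * x * ((6 * (q : ℝ) ^ 4 + 1) * (4 * (2 ^ j * (q : ℝ) ^ 2) + 1) * x ^ 11) ^ rho T *
          N := by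
          rw [Real.mul_rpow (by positivity) (by positivity),
            Real.mul_rpow (by positivity) (by positivity)]
          ring
      _ ≤ 4 * x * 1 * N := by
          gcongr
          exact Real.rpow_le_one (by positivity) hgrow hρ
      -- Here `4x ≤ 32/(250 · 2^j)`, since `q - 6 ≥ 250`.
      _ ≤ 0.128 * (1 / 2) ^ j * N := by
          refine mul_le_mul_of_nonneg_right ?_ hNn
          rw [hx, one_div_pow, mul_one, ← mul_div_assoc, mul_one_div,
            div_le_div_iff₀ hx250 (by positivity)]
          nlinarith
  have hU : (U.card : ℝ) ≤ 0.256 * N := by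
    calc (U.card : ℝ) ≤ ∑ j ∈ Finset.range (T.diam + 1),
          ((S.biUnion fun u => (D j u).biUnion fun v => (B u v).toFinset).card : ℝ) := by
          have h1 : U.card ≤ ∑ j ∈ Finset.range (T.diam + 1),
            (S.biUnion fun u => (D j u).biUnion fun v => (B u v).toFinset).card :=
            Finset.card_biUnion_le
          exact_mod_cast h1
      _ ≤ ∑ j ∈ Finset.range (T.diam + 1), 0.128 * (1 / 2) ^ j * N :=
          Finset.sum_le_sum fun j _ => hUj j
      _ = 0.128 * N * ∑ j ∈ Finset.range (T.diam + 1), (1 / (2 : ℝ)) ^ j := by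
          rw [Finset.mul_sum]
          exact Finset.sum_congr rfl fun j _ => by ring
      _ ≤ 0.128 * N * 2 := by
          gcongr
          exact sum_geometric_two_le _
      _ = 0.256 * N := by ring
  have hcompl : ({ω | Accepts T r X i (extend T r X i W ω) F}ᶜ.ncard : ℝ) ≤ U.card := by
    rw [← Set.ncard_coe_finset]
    exact_mod_cast Set.ncard_le_ncard (fun ω hω => hcover ω hω) (Set.toFinite _)
  have htot : ({ω | Accepts T r X i (extend T r X i W ω) F}.ncard : ℝ) +
      {ω | Accepts T r X i (extend T r X i W ω) F}ᶜ.ncard = N := by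
    rw [hN]
    exact_mod_cast Set.ncard_add_ncard_compl {ω | Accepts T r X i (extend T r X i W ω) F}
  have hNn : 0 ≤ N := Nat.cast_nonneg _
  linarith

end Probability

/-! ### The procedure can be carried out -/

section Existence

variable {V : Type u} {T : SimpleGraph V}

theorem exists_oriented (hT : T.IsTree) (r : V) {G : SimpleGraph V} (hG : G ≤ T) (e : G.edgeSet) :
    ∃ p : V × V, (e : Sym2 V) = s(p.1, p.2) ∧ depth T r p.1 = depth T r p.2 + 1 := by
  obtain ⟨e, he⟩ := e
  induction e with
  | _ u v =>
    rcases depth_adj hT r (hG he) with h | h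
    · exact ⟨(v, u), Sym2.eq_swap, h⟩
    · exact ⟨(u, v), rfl, h⟩

theorem cub_eq_zero_of_complete (h : ∀ u v, u ≠ v → T.Adj u v) : cub T = 0 := by
  refine Nat.le_zero.1 (Nat.sInf_le ⟨fun _ => 0, (isCubeRep_iff _ _).2 fun u v huv => ?_⟩)
  refine iff_of_true (h u v huv) ?_
  rw [Subsingleton.elim ((fun _ => 0 : V → Fin 0 → ℝ) u - (fun _ => 0 : V → Fin 0 → ℝ) v) 0,
    norm_zero]
  exact zero_le_one

variable [Fintype V] {r : V} {X : Side} {i : ℕ}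

theorem exists_component_isCubeRep [Nontrivial V] (hT : T.IsTree) (h : scale T r i ≤ 2 ^ 16)
    (F : (forest T r X i).ConnectedComponent) :
    ∃ f : F → Fin (tdim T) → ℝ, IsCubeRep F.toSimpleGraph f := by
  classical
  have hle := forest_le T r X i
  refine exists_isCubeRep_of_graded F.toSimpleGraph (fun v => depth T r v)
    (d := ⌈(22.77 : ℝ) * rho T⌉₊ + 1) ?_ ?_ ?_
  · rintro ⟨u, hu⟩ ⟨v, hv⟩ huv
    rw [SimpleGraph.ConnectedComponent.toSimpleGraph_adj] at huv
    exact depth_adj hT r (hle huv)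
  · rintro ⟨u, hu⟩ ⟨u', hu'⟩ ⟨v, hv⟩ huv huv' hd hd'
    rw [SimpleGraph.ConnectedComponent.toSimpleGraph_adj] at huv huv'
    exact Subtype.ext (parent_unique hT (hle huv) (hle huv') hd hd')
  · have h1 := card_component_le hT F
    have hρ := rho_nonneg hT
    have h2 : (scale T r i : ℝ) ≤ 65536 := by exact_mod_cast h
    -- `6 · 65536 + 1` is well below `2^22`, and `22 ≤ 22.77`.
    have h22 : (2 : ℝ) ^ (22 : ℝ) = 4194304 := by norm_num
    have h3 : (F.supp.ncard : ℝ) ≤ 2 ^ (⌈(22.77 : ℝ) * rho T⌉₊ + 1) := by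
      calc (F.supp.ncard : ℝ) ≤ 2 * (6 * (scale T r i : ℝ) + 1) ^ rho T := h1
        _ ≤ 2 * ((2 : ℝ) ^ (22 : ℝ)) ^ rho T := by
          rw [h22]
          gcongr
          linarith
        _ = 2 * (2 : ℝ) ^ (22 * rho T) := by rw [Real.rpow_mul (by norm_num)]
        _ ≤ 2 * (2 : ℝ) ^ (⌈(22.77 : ℝ) * rho T⌉₊ : ℝ) := by
          gcongr
          · norm_num
          · have := Nat.le_ceil ((22.77 : ℝ) * rho T)
            linarith
        _ = 2 ^ (⌈(22.77 : ℝ) * rho T⌉₊ + 1) := by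
          rw [Real.rpow_natCast]
          ring
    have h4 : Fintype.card F = F.supp.ncard := by
      rw [← Nat.card_eq_fintype_card]
      exact Nat.card_coe_set_eq F.supp
    rw [h4]
    exact_mod_cast h3

theorem exists_isBase [Nontrivial V] (hT : T.IsTree) (r : V) (X : Side) {i : ℕ}
    (h : scale T r i ≤ 2 ^ 16) :
    ∃ W : WeightAssignment (forest T r X i) (tdim T), IsBase T r X i W := by
  choose f hf using fun F => exists_component_isCubeRep (X := X) hT h (F := F)
  choose p hp hpd using exists_oriented hT r (forest_le T r X i)
  let g : V → Fin (tdim T) → ℝ := fun v => f ((forest T r X i).connectedComponentMk v) ⟨v, rfl⟩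
  have hg : ∀ (F : (forest T r X i).ConnectedComponent) (u : F), g u = f F u := by
    rintro F ⟨u, hu⟩
    obtain rfl : (forest T r X i).connectedComponentMk u = F := hu
    rfl
  -- The projection only serves to land in `[-1,1]`: adjacent centres are within distance `1`, so it
  -- changes nothing.
  refine ⟨fun e k => Set.projIcc (-1) 1 (by norm_num) (g (p e).1 k - g (p e).2 k),
    fun F => ⟨f F, hf F, fun u v huv hd k => ?_⟩⟩
  have hpe : p ⟨s((u : V), (v : V)), huv⟩ = ((u : V), (v : V)) := by
    have h1 := hp ⟨s((u : V), (v : V)), huv⟩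
    have h2 := hpd ⟨s((u : V), (v : V)), huv⟩
    rcases Sym2.eq_iff.1 h1 with ⟨h3, h4⟩ | ⟨h3, h4⟩
    · exact Prod.ext h3.symm h4.symm
    · rw [← h3, ← h4] at h2
      omega
  have hnorm : ‖f F u - f F v‖ ≤ 1 := by
    have hne : u ≠ v := by
      rintro rfl
      omega
    refine (((isCubeRep_iff _ _).1 (hf F)) u v hne).1 ?_
    exact (F.toSimpleGraph_adj u.2 v.2).2 huv
  have hk := (norm_le_pi_norm (f F u - f F v) k).trans hnorm
  rw [Pi.sub_apply, Real.norm_eq_abs, abs_le] at hk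
  simp only [hpe, hg F u, hg F v]
  rw [Set.projIcc_of_mem _ hk]

theorem Accepts.congr (hT : T.IsTree) {t : ℕ} {W W' : WeightAssignment (forest T r X i) t}
    {F : (forest T r X i).ConnectedComponent}
    (h : ∀ e : (forest T r X i).edgeSet, (∀ x ∈ (e : Sym2 V), x ∈ F.supp) → W e = W' e)
    (hW : Accepts T r X i W F) : Accepts T r X i W' F := by
  intro c hcF hmin u hu v hv huv hn hd
  have hc : IsTop T r F c := ⟨hcF, hmin⟩
  have hG := forest_le T r X i
  have key : ∀ u ∈ F.supp, pathSum (forest T r X i) W' c u = pathSum (forest T r X i) W c u := by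
    intro u hu
    funext k
    rw [hc.pathSum_eq hT hG hu, hc.pathSum_eq hT hG hu]
    refine Finset.sum_congr rfl fun j hj => ?_
    rw [Finset.mem_Ioc] at hj
    have he := hc.ancEdge_mem hT hG hu hj.1 hj.2
    rw [ext0_of_mem _ he, ext0_of_mem _ he, h]
    intro x hx
    have h1 := hc.anc_mem hT hG hu (j := j) hj.1.le hj.2
    rcases Sym2.mem_iff.1 hx with rfl | rfl
    · exact F.mem_supp_of_adj_mem_supp h1 (SimpleGraph.Adj.symm he)
    · exact h1
  rw [key u hu, key v hv]
  exact hW c hcF hmin u hu v hv huv hn hd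

theorem exists_extend_accepts [Nontrivial V] (hT : T.IsTree) (h : 2 ^ 16 < scale T r i)
    (W : WeightAssignment (forest T r X (i + 2)) (tdim T)) :
    ∃ ω, ∀ F, Accepts T r X i (extend T r X i W ω) F := by
  have hex : ∀ F, ∃ ω, Accepts T r X i (extend T r X i W ω) F := by
    intro F
    have h1 := extend_accepts_prob hT h W F
    have h2 : (0 : ℝ) < Nat.card ((forest T r X i).edgeSet → Fin (tdim T) → Bool) := by
      exact_mod_cast Nat.card_pos
    have h3 : (0 : ℝ) < {ω | Accepts T r X i (extend T r X i W ω) F}.ncard := by linarith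
    have h4 : 0 < {ω | Accepts T r X i (extend T r X i W ω) F}.ncard := by exact_mod_cast h3
    exact (Set.ncard_pos (Set.toFinite _)).1 h4
  choose ω hω using hex
  choose p hp _ using exists_oriented hT r (forest_le T r X i)
  -- Each edge uses the bits chosen for its own component.
  refine ⟨fun e => ω ((forest T r X i).connectedComponentMk (p e).1) e, fun F =>
    (hω F).congr hT fun e he => ?_⟩
  have h1 : (p e).1 ∈ F.supp := he _ (by rw [hp e]; exact Sym2.mem_mk_left _ _)
  have h2 : (forest T r X i).connectedComponentMk (p e).1 = F := h1
  funext k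
  simp only [extend, h2]

/-- Recursion downwards in steps of two, starting from given values near the top index `m`. -/
noncomputable def downwardRec {α : ℕ → Type*} (base : ∀ i, α i) (next : ∀ i, α (i + 2) → α i)
    (m i : ℕ) : α i :=
  if i + 2 ≤ m then next i (downwardRec base next m (i + 2)) else base i
termination_by m - i

theorem nonempty_procedureRun [Nontrivial V] (hT : T.IsTree) (r : V) :
    Nonempty (ProcedureRun T r) := by
  classical
  have hb : ∀ (X : Side) (i : ℕ), ∃ W : WeightAssignment (forest T r X i) (tdim T),
      scale T r i ≤ 2 ^ 16 → IsBase T r X i W := by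
    intro X i
    by_cases h : scale T r i ≤ 2 ^ 16
    · obtain ⟨W, hW⟩ := exists_isBase hT r X h
      exact ⟨W, fun _ => hW⟩
    · exact ⟨fun _ _ => ⟨0, by norm_num⟩, fun h' => absurd h' h⟩
  choose base hbase using hb
  have hn : ∀ (X : Side) (i : ℕ) (W : WeightAssignment (forest T r X (i + 2)) (tdim T)),
      ∃ W' : WeightAssignment (forest T r X i) (tdim T),
        i + 2 ≤ max (evenIdx T r) (oddIdx T r) →
        (∃ ω, W' = extend T r X i W ω) ∧ ∀ F, Accepts T r X i W' F := by
    intro X i W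
    by_cases h : i + 2 ≤ max (evenIdx T r) (oddIdx T r)
    · obtain ⟨ω, hω⟩ := exists_extend_accepts hT (scale_gt_of_add_two_le h) W
      exact ⟨_, fun _ => ⟨⟨ω, rfl⟩, hω⟩⟩
    · exact ⟨fun _ _ => ⟨0, by norm_num⟩, fun h' => absurd h' h⟩
  choose next hnext using hn
  obtain ⟨m, hm, -, hidx⟩ := exists_idx T r
  have hm1 : scale T r (m + 1) ≤ 2 ^ 16 := (scale_anti T r (Nat.le_succ m)).trans hm
  have hmax : max (evenIdx T r) (oddIdx T r) = m + 1 := by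
    rcases hidx with ⟨h1, h2⟩ | ⟨h1, h2⟩ <;> rw [h1, h2] <;> simp
  let R : ∀ (X : Side) (i : ℕ), WeightAssignment (forest T r X i) (tdim T) := fun X i =>
    downwardRec (α := fun i => WeightAssignment (forest T r X i) (tdim T)) (base X) (next X)
      (max (evenIdx T r) (oddIdx T r)) i
  have hR : ∀ X i, ¬ i + 2 ≤ max (evenIdx T r) (oddIdx T r) → R X i = base X i := by
    intro X i h
    simp only [R]
    rw [downwardRec, if_neg h]
  refine ⟨⟨R, fun X => ?_, fun X => ?_, fun X i h => ?_⟩⟩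
  · rw [hR X _ (by omega)]
    apply hbase
    rcases hidx with ⟨h1, h2⟩ | ⟨h1, h2⟩
    · rwa [h1]
    · rwa [h2]
  · rw [hR X _ (by omega)]
    apply hbase
    rcases hidx with ⟨h1, h2⟩ | ⟨h1, h2⟩
    · rwa [h2]
    · rwa [h1]
  · have h1 : R X i = next X i (R X (i + 2)) := by
      simp only [R]
      rw [downwardRec, if_pos h]
    rw [h1]
    exact hnext X i _ h

theorem cub_le [Nontrivial V] (hT : T.IsTree) : cub T ≤ 4 * (⌈(22.77 : ℝ) * rho T⌉₊ + 2) := by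
  obtain ⟨r⟩ := hT.connected.nonempty
  obtain ⟨R⟩ := nonempty_procedureRun hT r
  exact Nat.sInf_le ⟨_, R.isCubeRep hT⟩

/-- Two non-adjacent vertices force a vertex with two neighbours, hence a ball of radius `1` with at
least three elements; and `log(3/2)/log 3 ≥ 1/3` because `(3/2)^3 ≥ 3`. -/
theorem one_third_le_rho [Nontrivial V] (hT : T.IsTree) {u v : V} (huv : u ≠ v)
    (hn : ¬ T.Adj u v) : 1 / 3 ≤ rho T := by
  obtain ⟨p, hp⟩ := hT.connected.exists_walk_length_eq_dist u v
  obtain ⟨x, a, b, hxa, hab, -, hxb⟩ :=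
    p.exists_adj_adj_not_adj_ne hp (hT.connected.one_lt_dist_of_ne_of_not_adj huv hn)
  have h3 : 3 ≤ {w : V | T.dist a w ≤ 1}.ncard := by
    rw [← Set.ncard_eq_three.2 ⟨x, a, b, hxa.ne, hxb, hab.ne, rfl⟩]
    refine Set.ncard_le_ncard ?_ (Set.toFinite _)
    rintro w (rfl | rfl | rfl)
    · exact (SimpleGraph.dist_eq_one_iff_adj.2 hxa.symm).le
    · simp
    · exact (SimpleGraph.dist_eq_one_iff_adj.2 hab).le
  have h3' : (3 : ℝ) ≤ {w : V | T.dist a w ≤ 1}.ncard := by exact_mod_cast h3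
  refine le_trans ?_ (le_rho T a le_rfl (one_le_diam hT))
  have hlog : 0 < Real.logb 2 3 := Real.logb_pos (by norm_num) (by norm_num)
  have h1 : Real.logb 2 3 ≤ 3 * Real.logb 2 (3 / 2) := by
    have : 3 * Real.logb 2 (3 / 2) = Real.logb 2 ((3 / 2) ^ 3) := by
      rw [Real.logb_pow]
      norm_num
    rw [this]
    exact Real.logb_le_logb_of_le (by norm_num) (by norm_num) (by norm_num)
  have h2 : Real.logb 2 (3 / 2) ≤ Real.logb 2 (({w : V | T.dist a w ≤ 1}.ncard : ℝ) / 2) :=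
    Real.logb_le_logb_of_le (by norm_num) (by norm_num) (by linarith)
  have h4 : (2 * ((1 : ℕ) : ℝ) + 1) = 3 := by norm_num
  rw [h4, div_le_div_iff₀ (by norm_num) hlog]
  linarith

theorem cub_le_mul_rho [Nontrivial V] (hT : T.IsTree) : (cub T : ℝ) ≤ 128 * rho T := by
  by_cases h : ∀ u v, u ≠ v → T.Adj u v
  · rw [cub_eq_zero_of_complete h]
    have := rho_nonneg hT
    push_cast
    positivity
  · push Not at h
    obtain ⟨u, v, huv, hn⟩ := h
    have h1 := one_third_le_rho hT huv hn
    have h2 : (cub T : ℝ) ≤ ((4 * (⌈(22.77 : ℝ) * rho T⌉₊ + 2) : ℕ) : ℝ) := Nat.cast_le.2 (cub_le hT)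
    -- The bound is at most `91.08ρ + 12`, and `12 ≤ 36ρ`, which gives `127.08ρ`.
    have h3 := Nat.ceil_lt_add_one (a := (22.77 : ℝ) * rho T) (by linarith)
    push_cast at h2
    norm_num at h2 h3
    linarith

end Existence

end TreeCubicity

/-! ### The theorem -/

open TreeCubicity Classical in
theorem mainTheorem2 :
    (∀ (V : Type u) [Fintype V] [Nontrivial V] (T : SimpleGraph V) (_ : T.IsTree) (r : V),
      -- every weight-vector assignment produced by the procedure separates all non-adjacent pairs,
      -- and its vertex sums are the centres of a cube representation
      (∀ R : ProcedureRun T r,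
        (∀ u v : V, u ≠ v → ¬ T.Adj u v → Separates T r R.output u v) ∧
        IsCubeRep T (fun v => pathSum T R.output r v)) ∧
      -- the random extensions succeed with probability at least `0.64`
      (∀ (X : Side) (i : ℕ), i + 2 ≤ max (evenIdx T r) (oddIdx T r) →
        ∀ (W : WeightAssignment (forest T r X (i + 2)) (tdim T))
          (F : (forest T r X i).ConnectedComponent),
          (0.64 : ℝ) * Fintype.card ((forest T r X i).edgeSet → Fin (tdim T) → Bool) ≤
            Fintype.card {ω : (forest T r X i).edgeSet → Fin (tdim T) → Bool //
              Accepts T r X i (extend T r X i W ω) F}) ∧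
      -- the procedure can be carried out
      Nonempty (ProcedureRun T r) ∧
      cub T ≤ 4 * (⌈(22.77 : ℝ) * rho T⌉₊ + 2)) ∧
    (∃ C : ℝ, 0 < C ∧ ∀ (V : Type u) [Fintype V] [Nontrivial V] (T : SimpleGraph V),
      T.IsTree → (cub T : ℝ) ≤ C * rho T) := by
  refine ⟨fun V _ _ T hT r => ⟨fun R => ⟨fun u v huv hn => R.separates hT huv hn, R.isCubeRep hT⟩,
    fun X i hi W F => ?_, nonempty_procedureRun hT r, cub_le hT⟩,
    128, by norm_num, fun V _ _ T hT => cub_le_mul_rho hT⟩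
  rw [← Nat.card_eq_fintype_card, ← Nat.card_eq_fintype_card]
  exact extend_accepts_prob hT (scale_gt_of_add_two_le hi) W F
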